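/- Let $K$ be an algebraically closed field of characteristic $0$, let $X=\mathbb P^{n_1}\times\cdots\times\mathbb P^{n_k}$ over $K$ with projections $\pi_i:X\to\mathbb P^{n_i}$, and let $\epsilon_i\in\mathbb N^k$ be the $i$-th standard basis vector. For a closed subscheme $W\subset X$ with ideal sheaf $\mathcal I_W$ and $b=(b_1,\dots,b_k)\in\mathbb N^k$ put $\mathcal I_W(b)=\mathcal I_W\otimes\mathcal O_X(b_1,\dots,b_k)$ and $h^1(\mathcal I_W(b))=\dim_K H^1(X,\mathcal I_W(b))$. Let $Z\subset X$ be a zero-dimensional closed subscheme (possibly non-reduced or empty), let $i\in\{1,\dots,k\}$ and let $a=(a_1,\dots,a_k)\in\mathbb N^k$. Then $H^1(X,\mathcal I_Z(b))$ is finite-dimensional for all $b\in\mathbb N^k$, and: 1. $h^1(\mathcal I_Z(a+\epsilon_i))\le h^1(\mathcal I_Z(a))$. 2. If there is a closed point $p\in\mathbb P^{n_i}$ such that $Z\subset\pi_i^{-1}(p)$ (inclusion of schemes), then $h^1(\mathcal I_Z(a+\epsilon_i))=h^1(\mathcal I_Z(a))$. 3. The limit $\lim_{t\to+\infty}h^1(\mathcal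 I_Z(a+t\epsilon_i))$ exists, and it is positive if and only if there is a closed point $p\in\mathbb P^{n_i}$ such that $h^1(\mathcal I_{\pi_i^{-1}(p)\cap Z}(a))>0$, where $\pi_i^{-1}(p)\cap Z$ is the scheme-theoretic intersection. -/

import Mathlib

/-! Multiprojective spaces `X = ℙ^{n 0} × ⋯ × ℙ^{n (k-1)}` over a field, their closed subschemes
(quasi-coherent ideal sheaves, given on the standard affine cover), the twists `𝓘_Z(a)` and the
first Čech cohomology of these twists with respect to the standard affine cover. -/

open Filter Topology

noncomputable section

namespace MultiProj

/-- The field of fractions of the multigraded coordinate ring `K[x_{ij}]`, where `i : Fin k` and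
`0 ≤ j ≤ n i`. The rings of functions on the affine opens used below are subrings of it, and the
sections of the sheaves `𝒪_X(a)` are `K`-subspaces of it. -/
def Frac (K : Type*) [Field K] {k : ℕ} (n : Fin k → ℕ) : Type _ :=
  FractionRing (MvPolynomial (Σ i : Fin k, Fin (n i + 1)) K)

instance (K : Type*) [Field K] {k : ℕ} (n : Fin k → ℕ) : Field (Frac K n) :=
  inferInstanceAs (Field (FractionRing (MvPolynomial (Σ i : Fin k, Fin (n i + 1)) K)))

instance (K : Type*) [Field K] {k : ℕ} (n : Fin k → ℕ) :
    Algebra (MvPolynomial (Σ i : Fin k, Fin (n i + 1)) K) (Frac K n) :=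
  inferInstanceAs (Algebra (MvPolynomial (Σ i : Fin k, Fin (n i + 1)) K)
    (FractionRing (MvPolynomial (Σ i : Fin k, Fin (n i + 1)) K)))

instance (K : Type*) [Field K] {k : ℕ} (n : Fin k → ℕ) :
    IsFractionRing (MvPolynomial (Σ i : Fin k, Fin (n i + 1)) K) (Frac K n) :=
  inferInstanceAs (IsFractionRing (MvPolynomial (Σ i : Fin k, Fin (n i + 1)) K)
    (FractionRing (MvPolynomial (Σ i : Fin k, Fin (n i + 1)) K)))

instance (K : Type*) [Field K] {k : ℕ} (n : Fin k → ℕ) : Algebra K (Frac K n) :=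
  inferInstanceAs (Algebra K (FractionRing (MvPolynomial (Σ i : Fin k, Fin (n i + 1)) K)))

instance (K : Type*) [Field K] {k : ℕ} (n : Fin k → ℕ) :
    IsScalarTower K (MvPolynomial (Σ i : Fin k, Fin (n i + 1)) K) (Frac K n) :=
  inferInstanceAs (IsScalarTower K (MvPolynomial (Σ i : Fin k, Fin (n i + 1)) K)
    (FractionRing (MvPolynomial (Σ i : Fin k, Fin (n i + 1)) K)))

/-- The homogeneous coordinate `x_{ij}`. -/
def coord (K : Type*) [Field K] {k : ℕ} (n : Fin k → ℕ) (i : Fin k) (j : Fin (n i + 1)) :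
    Frac K n :=
  algebraMap (MvPolynomial (Σ i : Fin k, Fin (n i + 1)) K) (Frac K n) (MvPolynomial.X ⟨i, j⟩)

/-- The standard affine charts of `X`: the index `σ` stands for the affine open
`U_σ = {x_{i,σ(i)} ≠ 0 for all i}`, an affine space of dimension `∑ n i`. -/
abbrev Chart {k : ℕ} (n : Fin k → ℕ) : Type := (i : Fin k) → Fin (n i + 1)

/-- The ring `𝒪_X(U_σ) = K[x_{ij} / x_{i,σ(i)}]`. -/
def chartRing (K : Type*) [Field K] {k : ℕ} (n : Fin k → ℕ) (σ : Chart n) :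
    Subalgebra K (Frac K n) :=
  Algebra.adjoin K {f | ∃ (i : Fin k) (j : Fin (n i + 1)), f = coord K n i j / coord K n i (σ i)}

/-- The ring `𝒪_X(U_σ ∩ U_τ) = K[x_{ij} / x_{i,σ(i)}, x_{ij} / x_{i,τ(i)}]`. -/
def overlapRing (K : Type*) [Field K] {k : ℕ} (n : Fin k → ℕ) (σ τ : Chart n) :
    Subalgebra K (Frac K n) :=
  chartRing K n σ ⊔ chartRing K n τ

/-- Restriction of functions from `U_σ` to `U_σ ∩ U_τ`. -/
def resLeft (K : Type*) [Field K] {k : ℕ} (n : Fin k → ℕ) (σ τ : Chart n) :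
    chartRing K n σ →ₐ[K] overlapRing K n σ τ :=
  Subalgebra.inclusion le_sup_left

/-- Restriction of functions from `U_τ` to `U_σ ∩ U_τ`. -/
def resRight (K : Type*) [Field K] {k : ℕ} (n : Fin k → ℕ) (σ τ : Chart n) :
    chartRing K n τ →ₐ[K] overlapRing K n σ τ :=
  Subalgebra.inclusion le_sup_right

/-- The affine coordinate `x_{ij} / x_{i,σ(i)}` on `U_σ`. -/
def affineCoord (K : Type*) [Field K] {k : ℕ} (n : Fin k → ℕ) (σ : Chart n) (i : Fin k)
    (j : Fin (n i + 1)) : chartRing K n σ :=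
  ⟨coord K n i j / coord K n i (σ i), Algebra.subset_adjoin ⟨i, j, rfl⟩⟩

theorem coe_resLeft (K : Type*) [Field K] {k : ℕ} (n : Fin k → ℕ) (σ τ : Chart n)
    (f : chartRing K n σ) : (resLeft K n σ τ f : Frac K n) = f :=
  Subalgebra.coe_inclusion _ _

theorem coe_resRight (K : Type*) [Field K] {k : ℕ} (n : Fin k → ℕ) (σ τ : Chart n)
    (f : chartRing K n τ) : (resRight K n σ τ f : Frac K n) = f :=
  Subalgebra.coe_inclusion _ _

theorem coe_affineCoord (K : Type*) [Field K] {k : ℕ} (n : Fin k → ℕ) (σ : Chart n) (i : Fin k)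
    (j : Fin (n i + 1)) :
    (affineCoord K n σ i j : Frac K n) = coord K n i j / coord K n i (σ i) :=
  rfl

/-- A closed subscheme `Z` of `X`, given by its quasi-coherent ideal sheaf `𝓘_Z`: an ideal
`𝓘_Z(U_σ)` of `𝒪_X(U_σ)` for every standard chart, such that any two of them restrict to the same
ideal of `𝒪_X(U_σ ∩ U_τ)`. -/
@[ext]
structure ClosedSubscheme (K : Type*) [Field K] {k : ℕ} (n : Fin k → ℕ) where
  ideal : (σ : Chart n) → Ideal (chartRing K n σ)
  compat : ∀ σ τ : Chart n,
    (ideal σ).map (resLeft K n σ τ) = (ideal τ).map (resRight K n σ τ)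

theorem coord_ne_zero (K : Type*) [Field K] {k : ℕ} (n : Fin k → ℕ) (i : Fin k)
    (j : Fin (n i + 1)) : coord K n i j ≠ 0 := by
  unfold coord
  rw [Ne, map_eq_zero_iff _ (IsFractionRing.injective _ _)]
  exact MvPolynomial.X_ne_zero _

/-- The ideal of `π_i⁻¹(p) ∩ U_σ` in `𝒪_X(U_σ)`, where `π_i : X → ℙ^{n i}` is the `i`-th
projection. The closed point `p = [p_0 : ⋯ : p_{n i}]` is cut out in `ℙ^{n i}` by the linear forms
`p_j x_{il} - p_l x_{ij}`; on the chart they are divided by `x_{i,σ(i)}`. -/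
def fiberIdeal (K : Type*) [Field K] {k : ℕ} (n : Fin k → ℕ) (i : Fin k)
    (p : Projectivization K (Fin (n i + 1) → K)) (σ : Chart n) : Ideal (chartRing K n σ) :=
  Ideal.span {f | ∃ j l : Fin (n i + 1),
    f = p.rep j • affineCoord K n σ i l - p.rep l • affineCoord K n σ i j}

theorem fiberIdeal_compat (K : Type*) [Field K] {k : ℕ} (n : Fin k → ℕ) (i : Fin k)
    (p : Projectivization K (Fin (n i + 1) → K)) (σ τ : Chart n) :
    (fiberIdeal K n i p σ).map (resLeft K n σ τ) =
      (fiberIdeal K n i p τ).map (resRight K n σ τ) := by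
  unfold fiberIdeal
  rw [Ideal.map_span, Ideal.map_span]
  have hσ := coord_ne_zero K n i (σ i)
  have hτ := coord_ne_zero K n i (τ i)
  apply le_antisymm
  · rw [Ideal.span_le]
    rintro _ ⟨_, ⟨j, l, rfl⟩, rfl⟩
    have h : resLeft K n σ τ (p.rep j • affineCoord K n σ i l - p.rep l • affineCoord K n σ i j) =
        resLeft K n σ τ (affineCoord K n σ i (τ i)) *
          resRight K n σ τ
            (p.rep j • affineCoord K n τ i l - p.rep l • affineCoord K n τ i j) := by
      apply Subtype.ext
      simp only [Subalgebra.coe_mul, coe_resLeft, coe_resRight, Subalgebra.coe_sub,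
        Subalgebra.coe_smul, coe_affineCoord]
      simp only [Algebra.smul_def]
      field_simp
    rw [h]
    exact Ideal.mul_mem_left _ _ (Ideal.subset_span ⟨_, ⟨j, l, rfl⟩, rfl⟩)
  · rw [Ideal.span_le]
    rintro _ ⟨_, ⟨j, l, rfl⟩, rfl⟩
    have h : resRight K n σ τ (p.rep j • affineCoord K n τ i l - p.rep l • affineCoord K n τ i j) =
        resRight K n σ τ (affineCoord K n τ i (σ i)) *
          resLeft K n σ τ
            (p.rep j • affineCoord K n σ i l - p.rep l • affineCoord K n σ i j) := by
      apply Subtype.ext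
      simp only [Subalgebra.coe_mul, coe_resLeft, coe_resRight, Subalgebra.coe_sub,
        Subalgebra.coe_smul, coe_affineCoord]
      simp only [Algebra.smul_def]
      field_simp
    rw [h]
    exact Ideal.mul_mem_left _ _ (Ideal.subset_span ⟨_, ⟨j, l, rfl⟩, rfl⟩)

/-- The fiber `π_i⁻¹(p)` of the projection `π_i : X → ℙ^{n i}`, as a closed subscheme of `X`. -/
def fiber (K : Type*) [Field K] {k : ℕ} (n : Fin k → ℕ) (i : Fin k)
    (p : Projectivization K (Fin (n i + 1) → K)) : ClosedSubscheme K n where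
  ideal := fiberIdeal K n i p
  compat := fiberIdeal_compat K n i p

namespace ClosedSubscheme

/-- The scheme-theoretic intersection `Z ∩ W`, with ideal sheaf `𝓘_Z + 𝓘_W`. -/
def inter {K : Type*} [Field K] {k : ℕ} {n : Fin k → ℕ} (Z W : ClosedSubscheme K n) :
    ClosedSubscheme K n where
  ideal σ := Z.ideal σ ⊔ W.ideal σ
  compat σ τ := by rw [Ideal.map_sup, Ideal.map_sup, Z.compat, W.compat]

/-- The scheme-theoretic inclusion `Z ⊆ W`, that is `𝓘_W ⊆ 𝓘_Z`. -/
def IsContainedIn {K : Type*} [Field K] {k : ℕ} {n : Fin k → ℕ} (Z W : ClosedSubscheme K n) :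
    Prop :=
  ∀ σ, W.ideal σ ≤ Z.ideal σ

/-- `Z` is zero-dimensional: the coordinate ring of the affine scheme `Z ∩ U_σ` has Krull
dimension at most `0` for every chart (it is the zero ring where `Z ∩ U_σ` is empty; the empty
scheme is allowed). -/
def IsZeroDimensional {K : Type*} [Field K] {k : ℕ} {n : Fin k → ℕ} (Z : ClosedSubscheme K n) :
    Prop :=
  ∀ σ, ringKrullDim (chartRing K n σ ⧸ Z.ideal σ) ≤ 0

end ClosedSubscheme

/-- The monomial `x_σ^a = ∏ i, x_{i,σ(i)} ^ (a i)`, which generates the line bundle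
`𝒪_X(a) = 𝒪_X(a_1, …, a_k)` over `U_σ`. -/
def chartMonomial (K : Type*) [Field K] {k : ℕ} (n : Fin k → ℕ) (a : Fin k → ℕ) (σ : Chart n) :
    Frac K n :=
  ∏ i, coord K n i (σ i) ^ a i

/-- The `K`-subspace `u · J` of a field `L`, for an ideal `J` of a subalgebra `A` of `L`. -/
def scaledIdeal {K L : Type*} [Field K] [Field L] [Algebra K L] (u : L) (A : Subalgebra K L)
    (J : Ideal A) : Submodule K L :=
  (J.restrictScalars K).map (LinearMap.mulLeft K u ∘ₗ A.val.toLinearMap)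

theorem mem_scaledIdeal {K L : Type*} [Field K] [Field L] [Algebra K L] {u : L}
    {A : Subalgebra K L} {J : Ideal A} {f : L} :
    f ∈ scaledIdeal u A J ↔ ∃ g ∈ J, u * (g : L) = f :=
  Iff.rfl

namespace ClosedSubscheme

/-- The sections of `𝓘_Z(a) = 𝓘_Z ⊗ 𝒪_X(a)` over `U_σ`: the subspace `x_σ^a · 𝓘_Z(U_σ)`. -/
def sections {K : Type*} [Field K] {k : ℕ} {n : Fin k → ℕ} (Z : ClosedSubscheme K n)
    (a : Fin k → ℕ) (σ : Chart n) : Submodule K (Frac K n) :=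
  scaledIdeal (chartMonomial K n a σ) (chartRing K n σ) (Z.ideal σ)

/-- The sections of `𝓘_Z(a)` over `U_σ ∩ U_τ`: the subspace `x_σ^a · 𝓘_Z(U_σ ∩ U_τ)`. -/
def overlapSections {K : Type*} [Field K] {k : ℕ} {n : Fin k → ℕ} (Z : ClosedSubscheme K n)
    (a : Fin k → ℕ) (σ τ : Chart n) : Submodule K (Frac K n) :=
  scaledIdeal (chartMonomial K n a σ) (overlapRing K n σ τ)
    ((Z.ideal σ).map (resLeft K n σ τ))

/-- The Čech `0`-cochains of `𝓘_Z(a)`: a section over every chart. -/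
def cochain0 {K : Type*} [Field K] {k : ℕ} {n : Fin k → ℕ} (Z : ClosedSubscheme K n)
    (a : Fin k → ℕ) : Submodule K (Chart n → Frac K n) :=
  Submodule.pi Set.univ fun σ => Z.sections a σ

/-- The Čech `1`-cochains of `𝓘_Z(a)`: a section over every ordered pairwise intersection. -/
def cochain1 {K : Type*} [Field K] {k : ℕ} {n : Fin k → ℕ} (Z : ClosedSubscheme K n)
    (a : Fin k → ℕ) : Submodule K (Chart n → Chart n → Frac K n) :=
  Submodule.pi Set.univ fun σ => Submodule.pi Set.univ fun τ => Z.overlapSections a σ τ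

end ClosedSubscheme

/-- The Čech differential `(d g)_{στ} = g_τ - g_σ`. -/
def cechD0 (K : Type*) [Field K] {k : ℕ} (n : Fin k → ℕ) :
    (Chart n → Frac K n) →ₗ[K] (Chart n → Chart n → Frac K n) where
  toFun g := fun σ τ => g τ - g σ
  map_add' g h := by funext σ τ; simp only [Pi.add_apply]; ring
  map_smul' c g := by funext σ τ; simp only [Pi.smul_apply, RingHom.id_apply, smul_sub]

/-- The Čech differential `(d f)_{στρ} = f_{τρ} - f_{σρ} + f_{στ}`. -/
def cechD1 (K : Type*) [Field K] {k : ℕ} (n : Fin k → ℕ) :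
    (Chart n → Chart n → Frac K n) →ₗ[K] (Chart n → Chart n → Chart n → Frac K n) where
  toFun f := fun σ τ ρ => f τ ρ - f σ ρ + f σ τ
  map_add' f g := by funext σ τ ρ; simp only [Pi.add_apply]; ring
  map_smul' c f := by
    funext σ τ ρ; simp only [Pi.smul_apply, RingHom.id_apply, smul_sub, smul_add]

namespace ClosedSubscheme

/-- The Čech `1`-cocycles of `𝓘_Z(a)`. The restriction maps of the sheaf are inclusions of
subspaces of `Frac K n`, so the condition can be tested there. -/
def cocycle1 {K : Type*} [Field K] {k : ℕ} {n : Fin k → ℕ} (Z : ClosedSubscheme K n)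
    (a : Fin k → ℕ) : Submodule K (Chart n → Chart n → Frac K n) :=
  Z.cochain1 a ⊓ LinearMap.ker (cechD1 K n)

/-- The Čech `1`-coboundaries of `𝓘_Z(a)`. -/
def coboundary1 {K : Type*} [Field K] {k : ℕ} {n : Fin k → ℕ} (Z : ClosedSubscheme K n)
    (a : Fin k → ℕ) : Submodule K (Chart n → Chart n → Frac K n) :=
  (Z.cochain0 a).map (cechD0 K n)

theorem sections_le_left {K : Type*} [Field K] {k : ℕ} {n : Fin k → ℕ} (Z : ClosedSubscheme K n)
    (a : Fin k → ℕ) (σ τ : Chart n) : Z.sections a σ ≤ Z.overlapSections a σ τ := by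
  intro x hx
  obtain ⟨f, hf, rfl⟩ := mem_scaledIdeal.1 hx
  refine mem_scaledIdeal.2 ⟨resLeft K n σ τ f, Ideal.mem_map_of_mem _ hf, ?_⟩
  rw [coe_resLeft]

theorem sections_le_right {K : Type*} [Field K] {k : ℕ} {n : Fin k → ℕ} (Z : ClosedSubscheme K n)
    (a : Fin k → ℕ) (σ τ : Chart n) : Z.sections a τ ≤ Z.overlapSections a σ τ := by
  intro x hx
  obtain ⟨f, hf, rfl⟩ := mem_scaledIdeal.1 hx
  refine mem_scaledIdeal.2
    ⟨resLeft K n σ τ (∏ i, affineCoord K n σ i (τ i) ^ a i) * resRight K n σ τ f, ?_, ?_⟩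
  · refine Ideal.mul_mem_left _ _ ?_
    rw [Z.compat σ τ]
    exact Ideal.mem_map_of_mem _ hf
  · rw [Subalgebra.coe_mul, coe_resLeft, coe_resRight, ← mul_assoc]
    congr 1
    rw [SubmonoidClass.coe_finsetProd]
    unfold chartMonomial
    rw [← Finset.prod_mul_distrib]
    refine Finset.prod_congr rfl fun i _ => ?_
    rw [Subalgebra.coe_pow, coe_affineCoord, ← mul_pow,
      mul_div_cancel₀ _ (coord_ne_zero K n i (σ i))]

/-- The Čech differentials compose to zero on `𝓘_Z(a)`: coboundaries are cocycles. -/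
theorem coboundary1_le_cocycle1 {K : Type*} [Field K] {k : ℕ} {n : Fin k → ℕ}
    (Z : ClosedSubscheme K n) (a : Fin k → ℕ) : Z.coboundary1 a ≤ Z.cocycle1 a := by
  rintro _ ⟨g, hg, rfl⟩
  refine ⟨fun σ _ τ _ => ?_, ?_⟩
  · exact Submodule.sub_mem _ (Z.sections_le_right a σ τ (hg τ trivial))
      (Z.sections_le_left a σ τ (hg σ trivial))
  · refine LinearMap.mem_ker.2 ?_
    funext σ τ ρ
    simp only [cechD0, cechD1, LinearMap.coe_mk, AddHom.coe_mk, Pi.zero_apply]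
    ring

/-- The cohomology `H¹(X, 𝓘_Z(a))`, as the Čech cohomology of the quasi-coherent sheaf `𝓘_Z(a)`
with respect to the standard affine cover of the separated scheme `X`: cocycles modulo
coboundaries. -/
abbrev H1 {K : Type*} [Field K] {k : ℕ} {n : Fin k → ℕ} (Z : ClosedSubscheme K n)
    (a : Fin k → ℕ) : Type _ :=
  Z.cocycle1 a ⧸ (Z.coboundary1 a).submoduleOf (Z.cocycle1 a)

/-- `h¹(𝓘_Z(a)) = dim_K H¹(X, 𝓘_Z(a))`. -/
def h1 {K : Type*} [Field K] {k : ℕ} {n : Fin k → ℕ} (Z : ClosedSubscheme K n)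
    (a : Fin k → ℕ) : ℕ :=
  Module.finrank K (Z.H1 a)

end ClosedSubscheme

end MultiProj

end

noncomputable section

namespace MultiProj

/-! A zero-dimensional `Z` has finitely many closed points, so general linear forms `ℓ_i` vanish at
none of them (`exists_isUnitOn`), and `Z` lies in the affine open `{ℓ_i ≠ 0 for all i}`. Write `B`
for its coordinate ring, `J` for the ideal of `Z` in `B`, and `V_a ⊆ B` for the global sections of
`𝒪_X(a)` divided by `∏ ℓ_i ^ a_i`. Since `H¹(X, 𝒪_X(a)) = 0`, the sequence `0 → 𝓘_Z(a) → 𝒪_X(a) →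
𝒪_Z → 0` gives `H¹(X, 𝓘_Z(a)) ≅ B / (V_a + J)` (`nonempty_quotient_equiv_H1`), where `B / J` is
finite-dimensional.

Let `y_j = x_{ij} / ℓ_i`. Then `V_{a+ε_i} = ∑ y_j V_a`, and `∑ c_{ij} y_j = 1` gives `V_a ⊆
V_{a+ε_i}`, which is (1). If `Z` lies in a fiber of `π_i`, every `y_j` is a scalar modulo `J`, so
`V_a + J` does not change, which is (2).

For (3), the nonincreasing sequence of natural numbers is constant from some `T` on. There `U =
V_{a+Tε_i} + J` is stable under all `y_j`. If `U ≠ B`, the commuting operators `y_j` have a common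
eigenfunctional on `B / U`, with eigenvalues `μ_j`; it kills `V_a` and the ideal of `Z ∩
π_i⁻¹([μ])`, so `h¹` of this intersection is positive at `a`
(`exists_formSections_sup_inter_fiber_ne_top`). Conversely, by (2) `h¹` of `Z ∩ π_i⁻¹(p)` is the
same at `a` and at `a + Tε_i`, where it is at most that of `Z`. -/

theorem prod_zpow_eq_zpow_sum {L ι : Type*} [Field L] {x : L} (hx : x ≠ 0) (s : Finset ι)
    (f : ι → ℤ) : ∏ j ∈ s, x ^ f j = x ^ ∑ j ∈ s, f j := by
  classical
  induction s using Finset.induction_on with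
  | empty => simp
  | insert j s hj ih => rw [Finset.prod_insert hj, Finset.sum_insert hj, ih, zpow_add₀ hx]

/-! ### Laurent monomials and the coordinate rings of charts and overlaps -/

section LaurentMonomials

variable (K : Type*) [Field K] {k : ℕ} (n : Fin k → ℕ)

/-- The Laurent monomial `∏ x_{ij} ^ e_{ij}`. -/
def laurentMonomial (e : (Σ i : Fin k, Fin (n i + 1)) → ℤ) : Frac K n :=
  ∏ v, coord K n v.1 v.2 ^ e v

variable {K n}

theorem laurentMonomial_zero : laurentMonomial K n 0 = 1 := by
  simp [laurentMonomial]

theorem laurentMonomial_add (e f : (Σ i : Fin k, Fin (n i + 1)) → ℤ) :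
    laurentMonomial K n (e + f) = laurentMonomial K n e * laurentMonomial K n f := by
  simp only [laurentMonomial, ← Finset.prod_mul_distrib]
  exact Finset.prod_congr rfl fun v _ => zpow_add₀ (coord_ne_zero K n v.1 v.2) _ _

theorem laurentMonomial_ne_zero (e : (Σ i : Fin k, Fin (n i + 1)) → ℤ) :
    laurentMonomial K n e ≠ 0 :=
  Finset.prod_ne_zero_iff.2 fun v _ => zpow_ne_zero _ (coord_ne_zero K n v.1 v.2)

theorem laurentMonomial_neg (e : (Σ i : Fin k, Fin (n i + 1)) → ℤ) :
    laurentMonomial K n (-e) = (laurentMonomial K n e)⁻¹ := by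
  simp [laurentMonomial, Finset.prod_inv_distrib]

theorem laurentMonomial_sub (e f : (Σ i : Fin k, Fin (n i + 1)) → ℤ) :
    laurentMonomial K n (e - f) = laurentMonomial K n e / laurentMonomial K n f := by
  rw [sub_eq_add_neg, laurentMonomial_add, laurentMonomial_neg, div_eq_mul_inv]

theorem laurentMonomial_single (i : Fin k) (j : Fin (n i + 1)) (m : ℤ) :
    laurentMonomial K n (Pi.single ⟨i, j⟩ m) = coord K n i j ^ m := by
  unfold laurentMonomial
  rw [Finset.prod_eq_single (⟨i, j⟩ : Σ i : Fin k, Fin (n i + 1))]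
  · simp
  · intro v _ hv
    rw [Pi.single_eq_of_ne hv, zpow_zero]
  · simp

theorem laurentMonomial_eq_algebraMap (e : (Σ i : Fin k, Fin (n i + 1)) → ℤ) (he : ∀ v, 0 ≤ e v) :
    laurentMonomial K n e = algebraMap (MvPolynomial (Σ i : Fin k, Fin (n i + 1)) K) (Frac K n)
      (MvPolynomial.monomial (Finsupp.equivFunOnFinite.symm fun v => (e v).toNat) 1) := by
  rw [MvPolynomial.monomial_eq, map_one, one_mul, Finsupp.prod_fintype _ _ (by simp), map_prod]
  refine Finset.prod_congr rfl fun v _ => ?_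
  rw [map_pow]
  change _ = coord K n v.1 v.2 ^ _
  rw [← zpow_natCast]
  simp [Int.toNat_of_nonneg (he v)]

/-- Multiplying a finite relation by a suitable monomial clears all denominators and leaves a
relation between distinct monomials of the polynomial ring. -/
theorem linearIndependent_laurentMonomial : LinearIndependent K (laurentMonomial K n) := by
  rw [linearIndependent_iff']
  intro s g hg e he
  -- Large enough that `f + N` is nonnegative for every `f ∈ s` at once.
  let N : (Σ i : Fin k, Fin (n i + 1)) → ℤ := fun v => ∑ f ∈ s, |f v|
  have hN : ∀ f ∈ s, ∀ v, 0 ≤ (f + N) v := by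
    intro f hf v
    have h1 : |f v| ≤ N v := Finset.single_le_sum (f := fun f => |f v|) (fun _ _ => abs_nonneg _) hf
    have h2 := neg_abs_le (f v)
    simp only [Pi.add_apply]
    linarith
  let φ : ((Σ i : Fin k, Fin (n i + 1)) → ℤ) → ((Σ i : Fin k, Fin (n i + 1)) →₀ ℕ) :=
    fun f => Finsupp.equivFunOnFinite.symm fun v => ((f + N) v).toNat
  have h0 : algebraMap (MvPolynomial (Σ i : Fin k, Fin (n i + 1)) K) (Frac K n)
      (∑ f ∈ s, g f • MvPolynomial.monomial (φ f) 1) = 0 := by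
    have h1 : (∑ f ∈ s, g f • laurentMonomial K n f) * laurentMonomial K n N = 0 := by
      rw [hg, zero_mul]
    rw [Finset.sum_mul] at h1
    rw [map_sum, ← h1]
    refine Finset.sum_congr rfl fun f hf => ?_
    rw [smul_mul_assoc, ← laurentMonomial_add, laurentMonomial_eq_algebraMap _ (hN f hf)]
    exact map_smul (IsScalarTower.toAlgHom K _ (Frac K n)) (g f) _
  rw [map_eq_zero_iff _ (IsFractionRing.injective _ _)] at h0
  have h2 := congrArg (MvPolynomial.coeff (φ e)) h0
  rw [MvPolynomial.coeff_sum, Finset.sum_eq_single e] at h2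
  · simpa using h2
  · intro f hf hfe
    rw [MvPolynomial.coeff_smul, MvPolynomial.coeff_monomial, if_neg, smul_zero]
    intro h
    apply hfe
    funext v
    have h3 : ((f + N) v).toNat = ((e + N) v).toNat := DFunLike.congr_fun h v
    have h4 := hN f hf v
    have h5 := hN e he v
    simp only [Pi.add_apply] at h3 h4 h5
    omega
  · exact fun h => absurd he h

/-- The exponents of the Laurent monomials that are sections of `𝒪_X(a)` over `U_σ ∩ U_τ`. -/
def overlapExponents (a : Fin k → ℕ) (σ τ : Chart n) : Set ((Σ i : Fin k, Fin (n i + 1)) → ℤ) :=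
  {e | (∀ i, ∑ j, e ⟨i, j⟩ = a i) ∧ ∀ i j, j ≠ σ i → j ≠ τ i → 0 ≤ e ⟨i, j⟩}

/-- The exponents of the monomials that are global sections of `𝒪_X(a)`. -/
def globalExponents (n : Fin k → ℕ) (a : Fin k → ℕ) : Set ((Σ i : Fin k, Fin (n i + 1)) → ℤ) :=
  {e | (∀ i, ∑ j, e ⟨i, j⟩ = a i) ∧ ∀ v, 0 ≤ e v}

/-- The exponent of `x_σ^a`. -/
def chartExponent (a : Fin k → ℕ) (σ : Chart n) : (Σ i : Fin k, Fin (n i + 1)) → ℤ :=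
  fun v => if v.2 = σ v.1 then a v.1 else 0

theorem laurentMonomial_eq_prod_prod (e : (Σ i : Fin k, Fin (n i + 1)) → ℤ) :
    laurentMonomial K n e = ∏ i, ∏ j, coord K n i j ^ e ⟨i, j⟩ :=
  Fintype.prod_sigma _

theorem laurentMonomial_chartExponent (a : Fin k → ℕ) (σ : Chart n) :
    laurentMonomial K n (chartExponent a σ) = chartMonomial K n a σ := by
  rw [laurentMonomial_eq_prod_prod]
  refine Finset.prod_congr rfl fun i _ => ?_
  rw [Finset.prod_eq_single (σ i)]
  · simp [chartExponent]
  · intro j _ hj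
    simp [chartExponent, hj]
  · simp

theorem chartMonomial_ne_zero (a : Fin k → ℕ) (σ : Chart n) : chartMonomial K n a σ ≠ 0 :=
  laurentMonomial_chartExponent (K := K) a σ ▸ laurentMonomial_ne_zero _

theorem sum_chartExponent (a : Fin k → ℕ) (σ : Chart n) (i : Fin k) :
    ∑ j, chartExponent a σ ⟨i, j⟩ = a i := by
  simp [chartExponent]

/-- A subalgebra generated by Laurent monomials whose exponents lie in an additive submonoid is
spanned by Laurent monomials with exponents in this submonoid. -/
theorem adjoin_le_span_laurentMonomial {s : Set (Frac K n)}
    (T : AddSubmonoid ((Σ i : Fin k, Fin (n i + 1)) → ℤ))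
    (hs : ∀ f ∈ s, ∃ e ∈ T, f = laurentMonomial K n e) :
    Subalgebra.toSubmodule (Algebra.adjoin K s) ≤ Submodule.span K (laurentMonomial K n '' T) := by
  rw [Algebra.adjoin_eq_span]
  refine Submodule.span_mono fun f hf => ?_
  induction hf using Submonoid.closure_induction with
  | mem f hf =>
    obtain ⟨e, he, rfl⟩ := hs f hf
    exact ⟨e, he, rfl⟩
  | one => exact ⟨0, T.zero_mem, laurentMonomial_zero⟩
  | mul f g _ _ hf hg =>
    obtain ⟨e, he, rfl⟩ := hf
    obtain ⟨e', he', rfl⟩ := hg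
    exact ⟨e + e', T.add_mem he he', laurentMonomial_add e e'⟩

theorem coord_div_coord_eq_laurentMonomial (i : Fin k) (j l : Fin (n i + 1)) :
    coord K n i j / coord K n i l =
      laurentMonomial K n (Pi.single ⟨i, j⟩ 1 - Pi.single ⟨i, l⟩ 1) := by
  rw [laurentMonomial_sub, laurentMonomial_single, laurentMonomial_single, zpow_one, zpow_one]

/-- The additive monoid of exponents of Laurent monomials regular on `U_σ ∩ U_τ`. -/
def overlapExponentMonoid (σ τ : Chart n) : AddSubmonoid ((Σ i : Fin k, Fin (n i + 1)) → ℤ) where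
  carrier := overlapExponents 0 σ τ
  zero_mem' := ⟨by simp, by simp⟩
  add_mem' {e f} he hf := by
    refine ⟨fun i => ?_, fun i j h1 h2 => add_nonneg (he.2 i j h1 h2) (hf.2 i j h1 h2)⟩
    simp only [Pi.add_apply, Finset.sum_add_distrib, he.1 i, hf.1 i]
    simp

theorem sum_single_exponent (i i' : Fin k) (j : Fin (n i + 1)) :
    ∑ l, (Pi.single ⟨i, j⟩ 1 : (Σ i : Fin k, Fin (n i + 1)) → ℤ) ⟨i', l⟩ =
      if i' = i then 1 else 0 := by
  split_ifs with h
  · subst h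
    rw [Finset.sum_eq_single j]
    · simp
    · intro l _ hl
      exact Pi.single_eq_of_ne (by simpa using hl) _
    · simp
  · refine Finset.sum_eq_zero fun l _ => Pi.single_eq_of_ne ?_ _
    intro h'
    exact h (congrArg Sigma.fst h')

theorem single_sub_single_mem (σ τ : Chart n) (i : Fin k) (j l : Fin (n i + 1))
    (hl : l = σ i ∨ l = τ i) :
    (Pi.single ⟨i, j⟩ 1 - Pi.single ⟨i, l⟩ 1 : (Σ i : Fin k, Fin (n i + 1)) → ℤ) ∈
      overlapExponentMonoid σ τ := by
  refine ⟨fun i' => ?_, fun i' j' h1 h2 => ?_⟩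
  · simp only [Pi.sub_apply, Finset.sum_sub_distrib, sum_single_exponent]
    simp
  · have h3 : (Pi.single ⟨i, l⟩ 1 : (Σ i : Fin k, Fin (n i + 1)) → ℤ) ⟨i', j'⟩ = 0 := by
      refine Pi.single_eq_of_ne ?_ _
      rintro h
      obtain ⟨rfl, h⟩ := Sigma.mk.inj h
      obtain rfl := eq_of_heq h
      tauto
    rw [Pi.sub_apply, h3, sub_zero]
    exact (Pi.single_nonneg.2 (zero_le_one (α := ℤ)) : (0 : (Σ i : Fin k, Fin (n i + 1)) → ℤ) ≤ _) _

theorem overlapRing_le_span (σ τ : Chart n) :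
    Subalgebra.toSubmodule (overlapRing K n σ τ) ≤
      Submodule.span K (laurentMonomial K n '' overlapExponents 0 σ τ) := by
  unfold overlapRing chartRing
  rw [← Algebra.adjoin_union]
  refine adjoin_le_span_laurentMonomial (overlapExponentMonoid σ τ) ?_
  rintro f (⟨i, j, rfl⟩ | ⟨i, j, rfl⟩)
  · exact ⟨_, single_sub_single_mem σ τ i j _ (Or.inl rfl), coord_div_coord_eq_laurentMonomial i j _⟩
  · exact ⟨_, single_sub_single_mem σ τ i j _ (Or.inr rfl), coord_div_coord_eq_laurentMonomial i j _⟩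

/-- The exponents in each factor sum to zero, so dividing every `x_{ij}` by `x_{i,σ(i)}` does not
change the monomial. -/
theorem laurentMonomial_mem_chartRing (σ : Chart n) (e : (Σ i : Fin k, Fin (n i + 1)) → ℤ)
    (he : e ∈ overlapExponents 0 σ σ) : laurentMonomial K n e ∈ chartRing K n σ := by
  have h : laurentMonomial K n e =
      ∏ i, ∏ j, (coord K n i j / coord K n i (σ i)) ^ (e ⟨i, j⟩) := by
    rw [laurentMonomial_eq_prod_prod]
    refine Finset.prod_congr rfl fun i _ => ?_
    simp only [div_zpow]
    rw [Finset.prod_div_distrib, prod_zpow_eq_zpow_sum (coord_ne_zero K n i (σ i)), he.1 i]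
    simp
  rw [h]
  refine prod_mem fun i _ => prod_mem fun j _ => ?_
  by_cases hj : j = σ i
  · rw [hj, div_self (coord_ne_zero K n i (σ i)), one_zpow]
    exact one_mem _
  · rw [← Int.toNat_of_nonneg (he.2 i j hj hj), zpow_natCast]
    exact pow_mem (affineCoord K n σ i j).2 _

end LaurentMonomials

/-! ### Global sections of `𝒪_X(a)` and the vanishing of its `H¹` -/

section StructureSheaf

variable {K : Type*} [Field K] {k : ℕ} {n : Fin k → ℕ}

theorem mem_scaledIdeal_iff_div {K L : Type*} [Field K] [Field L] [Algebra K L] {u : L}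
    (hu : u ≠ 0) {A : Subalgebra K L} {J : Ideal A} {f : L} :
    f ∈ scaledIdeal u A J ↔ ∃ g ∈ J, (g : L) = f / u := by
  rw [mem_scaledIdeal]
  refine exists_congr fun g => and_congr_right fun _ => ?_
  rw [eq_div_iff hu, mul_comm]

variable (K n) in
/-- The empty closed subscheme: its ideal sheaf is `𝒪_X`. -/
def emptyScheme : ClosedSubscheme K n where
  ideal _ := ⊤
  compat _ _ := by rw [Ideal.map_top, Ideal.map_top]

theorem mem_sections_emptyScheme {a : Fin k → ℕ} {σ : Chart n} {f : Frac K n} :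
    f ∈ (emptyScheme K n).sections a σ ↔ f / chartMonomial K n a σ ∈ chartRing K n σ := by
  unfold ClosedSubscheme.sections
  rw [mem_scaledIdeal_iff_div (chartMonomial_ne_zero a σ)]
  exact ⟨fun ⟨g, _, hg⟩ => hg ▸ g.2, fun h => ⟨⟨_, h⟩, trivial, rfl⟩⟩

theorem mem_overlapSections_emptyScheme {a : Fin k → ℕ} {σ τ : Chart n} {f : Frac K n} :
    f ∈ (emptyScheme K n).overlapSections a σ τ ↔
      f / chartMonomial K n a σ ∈ overlapRing K n σ τ := by
  unfold ClosedSubscheme.overlapSections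
  rw [mem_scaledIdeal_iff_div (chartMonomial_ne_zero a σ)]
  refine ⟨fun ⟨g, _, hg⟩ => hg ▸ g.2, fun h => ⟨⟨_, h⟩, ?_, rfl⟩⟩
  simp [emptyScheme, Ideal.map_top]

theorem sections_le_sections_emptyScheme (Z : ClosedSubscheme K n) (a : Fin k → ℕ) (σ : Chart n) :
    Z.sections a σ ≤ (emptyScheme K n).sections a σ := by
  rintro _ ⟨g, _, rfl⟩
  exact ⟨g, trivial, rfl⟩

theorem cocycle1_le_cocycle1_emptyScheme (Z : ClosedSubscheme K n) (a : Fin k → ℕ) :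
    Z.cocycle1 a ≤ (emptyScheme K n).cocycle1 a := by
  refine inf_le_inf_right _ fun c hc σ _ τ _ => ?_
  obtain ⟨g, _, hg⟩ := hc σ trivial τ trivial
  exact ⟨g, by simp [emptyScheme, Ideal.map_top], hg⟩

theorem laurentMonomial_mem_sections {a : Fin k → ℕ} {σ : Chart n}
    {e : (Σ i : Fin k, Fin (n i + 1)) → ℤ} (he : e ∈ overlapExponents a σ σ) :
    laurentMonomial K n e ∈ (emptyScheme K n).sections a σ := by
  rw [mem_sections_emptyScheme, ← laurentMonomial_chartExponent, ← laurentMonomial_sub]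
  refine laurentMonomial_mem_chartRing σ _ ⟨fun i => ?_, fun i j h1 h2 => ?_⟩
  · simp only [Pi.sub_apply, Finset.sum_sub_distrib, he.1 i, sum_chartExponent]
    simp
  · simpa [chartExponent, h1] using he.2 i j h1 h2

theorem overlapSections_emptyScheme_le_span (a : Fin k → ℕ) (σ τ : Chart n) :
    (emptyScheme K n).overlapSections a σ τ ≤
      Submodule.span K (laurentMonomial K n '' overlapExponents a σ τ) := by
  intro f hf
  have h := overlapRing_le_span σ τ (mem_overlapSections_emptyScheme.1 hf)
  have h1 := Submodule.mem_map_of_mem (f := LinearMap.mulLeft K (chartMonomial K n a σ)) h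
  rw [LinearMap.mulLeft_apply, mul_div_cancel₀ _ (chartMonomial_ne_zero a σ)] at h1
  refine (Submodule.map_span_le _ _ _).2 ?_ h1
  rintro _ ⟨e, he, rfl⟩
  refine Submodule.subset_span ⟨chartExponent a σ + e, ⟨fun i => ?_, fun i j h1 h2 => ?_⟩, ?_⟩
  · simp only [Pi.add_apply, Finset.sum_add_distrib, he.1 i, sum_chartExponent]
    simp
  · simpa [chartExponent, h1] using he.2 i j h1 h2
  · rw [laurentMonomial_add, laurentMonomial_chartExponent, LinearMap.mulLeft_apply]

variable (K n) in
/-- The global sections of `𝒪_X(a)`: the multihomogeneous polynomials of multidegree `a`. -/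
def globalSections (a : Fin k → ℕ) : Submodule K (Frac K n) :=
  Submodule.span K (laurentMonomial K n '' globalExponents n a)

theorem mem_span_laurentMonomial {T : Set ((Σ i : Fin k, Fin (n i + 1)) → ℤ)} {f : Frac K n} :
    f ∈ Submodule.span K (laurentMonomial K n '' T) ↔
      ∃ C ∈ Finsupp.supported K K T, Finsupp.linearCombination K (laurentMonomial K n) C = f := by
  rw [Finsupp.span_image_eq_map_linearCombination, Submodule.mem_map]

/-- An exponent of nonnegative multidegree is nonnegative at all `x_{i,ρ(i)}` for some `ρ`. -/
theorem exists_chart_exponent_nonneg {a : Fin k → ℕ} {e : (Σ i : Fin k, Fin (n i + 1)) → ℤ}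
    (he : ∀ i, ∑ j, e ⟨i, j⟩ = a i) : ∃ ρ : Chart n, ∀ i, 0 ≤ e ⟨i, ρ i⟩ := by
  have h : ∀ i, ∃ j, 0 ≤ e ⟨i, j⟩ := by
    intro i
    by_contra! hneg
    have h1 : ∑ j, e ⟨i, j⟩ < 0 :=
      Finset.sum_neg (fun j _ => hneg j) Finset.univ_nonempty
    rw [he i] at h1
    omega
  choose ρ hρ using h
  exact ⟨ρ, hρ⟩

theorem globalSections_le_sections (a : Fin k → ℕ) (σ : Chart n) :
    globalSections K n a ≤ (emptyScheme K n).sections a σ := by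
  refine Submodule.span_le.2 ?_
  rintro _ ⟨e, he, rfl⟩
  exact laurentMonomial_mem_sections ⟨he.1, fun i j _ _ => he.2 _⟩

/-- By linear independence the Laurent expansion is the same on all charts. An exponent `e` that
occurs is nonnegative at each `x_{i,ρ(i)}` for some chart `ρ`, and regularity on `U_ρ` makes its
other entries nonnegative. -/
theorem mem_globalSections_of_forall_mem_sections {a : Fin k → ℕ} {f : Frac K n}
    (hf : ∀ σ, f ∈ (emptyScheme K n).sections a σ) : f ∈ globalSections K n a := by
  have h : ∀ σ, ∃ C ∈ Finsupp.supported K K (overlapExponents a σ σ),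
      Finsupp.linearCombination K (laurentMonomial K n) C = f := fun σ =>
    mem_span_laurentMonomial.1 (overlapSections_emptyScheme_le_span a σ σ
      (ClosedSubscheme.sections_le_left _ a σ σ (hf σ)))
  obtain ⟨C, -, hC⟩ := h fun _ => 0
  have hmem : ∀ σ, C ∈ Finsupp.supported K K (overlapExponents a σ σ) := by
    intro σ
    obtain ⟨D, hD, hDf⟩ := h σ
    rwa [linearIndependent_laurentMonomial (hC.trans hDf.symm)]
  refine mem_span_laurentMonomial.2 ⟨C, ?_, hC⟩
  intro e he
  have hdeg := (hmem (fun _ => 0) he).1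
  obtain ⟨ρ, hρ⟩ := exists_chart_exponent_nonneg hdeg
  refine ⟨hdeg, ?_⟩
  rintro ⟨i, j⟩
  by_cases hj : j = ρ i
  · exact hj ▸ hρ i
  · exact (hmem ρ he).2 i j hj hj

/-- The vanishing of `H¹(X, 𝒪_X(a))` for `a ∈ ℕ^k`. -/
theorem cocycle1_emptyScheme_le_coboundary1 (a : Fin k → ℕ) :
    (emptyScheme K n).cocycle1 a ≤ (emptyScheme K n).coboundary1 a := by
  classical
  rintro c ⟨hc, hcd⟩
  have h : ∀ σ τ, ∃ C ∈ Finsupp.supported K K (overlapExponents a σ τ),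
      Finsupp.linearCombination K (laurentMonomial K n) C = c σ τ := fun σ τ =>
    mem_span_laurentMonomial.1 (overlapSections_emptyScheme_le_span a σ τ (hc σ trivial τ trivial))
  choose C hC hCc using h
  -- Linear independence turns the cocycle condition into an identity of coefficients, so each
  -- monomial can be treated separately.
  have hcocycle : ∀ σ τ ρ, C τ ρ - C σ ρ + C σ τ = 0 := by
    intro σ τ ρ
    refine linearIndependent_laurentMonomial (?_ : Finsupp.linearCombination K _ _ = _)
    rw [map_add, map_sub, map_zero, hCc, hCc, hCc]
    exact congrFun (congrFun (congrFun (LinearMap.mem_ker.1 hcd) σ) τ) ρ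
  have hρ : ∀ e : (Σ i : Fin k, Fin (n i + 1)) → ℤ, ∃ ρ : Chart n,
      (∀ i, ∑ j, e ⟨i, j⟩ = a i) → ∀ i, 0 ≤ e ⟨i, ρ i⟩ := by
    intro e
    by_cases he : ∀ i, ∑ j, e ⟨i, j⟩ = a i
    · obtain ⟨ρ, hρ⟩ := exists_chart_exponent_nonneg he
      exact ⟨ρ, fun _ => hρ⟩
    · exact ⟨fun _ => 0, fun h => absurd h he⟩
  choose ρ hρ using hρ
  let T : Finset ((Σ i : Fin k, Fin (n i + 1)) → ℤ) :=
    Finset.univ.biUnion fun p : Chart n × Chart n => (C p.1 p.2).support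
  -- A contracting homotopy, exponent by exponent: the coefficient of `e` over `U_σ` is that of the
  -- cocycle on `U_{ρ(e)} ∩ U_σ`. As `e` is nonnegative at the coordinates `x_{i,ρ(e)(i)}`, the
  -- monomial is regular on all of `U_σ`.
  let D : Chart n → (((Σ i : Fin k, Fin (n i + 1)) → ℤ) →₀ K) := fun σ =>
    Finsupp.onFinset T (fun e => C (ρ e) σ e) fun e he =>
      Finset.mem_biUnion.2 ⟨(ρ e, σ), Finset.mem_univ _, Finsupp.mem_support_iff.2 he⟩
  refine ⟨fun σ => Finsupp.linearCombination K (laurentMonomial K n) (D σ), fun σ _ => ?_, ?_⟩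
  · have hD : D σ ∈ Finsupp.supported K K (overlapExponents a σ σ) := by
      intro e he
      have h1 : C (ρ e) σ e ≠ 0 := by simpa [D] using he
      have h2 : e ∈ overlapExponents a (ρ e) σ := hC _ _ (Finsupp.mem_support_iff.2 h1)
      refine ⟨h2.1, fun i j hj _ => ?_⟩
      by_cases hjρ : j = ρ e i
      · exact hjρ ▸ hρ e h2.1 i
      · exact h2.2 i j hjρ hj
    have h1 := mem_span_laurentMonomial.2 ⟨D σ, hD, rfl⟩
    refine Submodule.span_le.2 ?_ h1
    rintro _ ⟨e, he, rfl⟩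
    exact laurentMonomial_mem_sections he
  · funext σ τ
    change Finsupp.linearCombination K (laurentMonomial K n) (D τ) -
      Finsupp.linearCombination K (laurentMonomial K n) (D σ) = c σ τ
    rw [← map_sub, ← hCc]
    congr 1
    ext e
    have h1 := DFunLike.congr_fun (hcocycle (ρ e) σ τ) e
    simp only [Finsupp.add_apply, Finsupp.sub_apply, Finsupp.zero_apply] at h1
    change C (ρ e) τ e - C (ρ e) σ e = C σ τ e
    linear_combination -h1

theorem coord_mul_mem_globalSections {a : Fin k → ℕ} (i : Fin k) (j : Fin (n i + 1))
    {f : Frac K n} (hf : f ∈ globalSections K n a) :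
    coord K n i j * f ∈ globalSections K n (a + Pi.single i 1) := by
  have h := Submodule.mem_map_of_mem (f := LinearMap.mulLeft K (coord K n i j)) hf
  refine (Submodule.map_span_le _ _ _).2 ?_ h
  rintro _ ⟨e, he, rfl⟩
  refine Submodule.subset_span ⟨Pi.single ⟨i, j⟩ 1 + e, ⟨fun i' => ?_, fun v => ?_⟩, ?_⟩
  · simp only [Pi.add_apply, Finset.sum_add_distrib, he.1 i', sum_single_exponent]
    by_cases h : i' = i
    · subst h; simp [add_comm]
    · simp [h]
  · have h1 : (0 : (Σ i : Fin k, Fin (n i + 1)) → ℤ) ≤ Pi.single ⟨i, j⟩ 1 :=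
      Pi.single_nonneg.2 zero_le_one
    exact add_nonneg (h1 v) (he.2 v)
  · rw [laurentMonomial_add, laurentMonomial_single, zpow_one, LinearMap.mulLeft_apply]

/-- Sections of `𝒪_X(a + ε_i)` are combinations of products of the coordinates `x_{ij}` with
sections of `𝒪_X(a)`. -/
theorem globalSections_add_single_le {a : Fin k → ℕ} (i : Fin k) {M : Submodule K (Frac K n)}
    (hM : ∀ j, ∀ f ∈ globalSections K n a, coord K n i j * f ∈ M) :
    globalSections K n (a + Pi.single i 1) ≤ M := by
  refine Submodule.span_le.2 ?_
  rintro _ ⟨e, he, rfl⟩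
  have h : ∃ j, 0 < e ⟨i, j⟩ := by
    by_contra! hneg
    have h1 : ∑ j, e ⟨i, j⟩ ≤ 0 := Finset.sum_nonpos fun j _ => hneg j
    rw [he.1 i] at h1
    simp at h1
    omega
  obtain ⟨j, hj⟩ := h
  have h1 : laurentMonomial K n e =
      coord K n i j * laurentMonomial K n (e - Pi.single ⟨i, j⟩ 1) := by
    rw [laurentMonomial_sub, laurentMonomial_single, zpow_one,
      mul_div_cancel₀ _ (coord_ne_zero K n i j)]
  rw [h1]
  refine hM j _ (Submodule.subset_span ⟨_, ⟨fun i' => ?_, fun v => ?_⟩, rfl⟩)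
  · simp only [Pi.sub_apply, Finset.sum_sub_distrib, he.1 i', sum_single_exponent]
    by_cases h : i' = i
    · subst h; simp
    · simp [h]
  · by_cases hv : v = ⟨i, j⟩
    · subst hv
      simp only [Pi.sub_apply, Pi.single_eq_same]
      omega
    · rw [Pi.sub_apply, Pi.single_eq_of_ne hv, sub_zero]
      exact he.2 v

end StructureSheaf

/-! ### Ideals of subalgebras of a field, clearing denominators and localization -/

section Saturation

variable {K L : Type*} [Field K] [Field L] [Algebra K L]

/-- An ideal of a subalgebra of `L`, as a subspace of `L`. -/
def idealImage {A : Subalgebra K L} (I : Ideal A) : Submodule K L :=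
  (I.restrictScalars K).map A.val.toLinearMap

theorem coe_mem_idealImage {A : Subalgebra K L} {I : Ideal A} {f : A} :
    (f : L) ∈ idealImage I ↔ f ∈ I :=
  ⟨fun ⟨_, hg, h⟩ => Subtype.ext h ▸ hg, fun h => ⟨f, h, rfl⟩⟩

theorem idealImage_le {A : Subalgebra K L} {I : Ideal A} {f : L} (hf : f ∈ idealImage I) :
    f ∈ A := by
  obtain ⟨g, _, rfl⟩ := hf
  exact g.2

theorem mul_mem_idealImage {A : Subalgebra K L} {I : Ideal A} {h f : L} (hh : h ∈ A)
    (hf : f ∈ idealImage I) : h * f ∈ idealImage I := by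
  obtain ⟨g, hg, rfl⟩ := hf
  exact ⟨⟨h, hh⟩ * g, I.mul_mem_left _ hg, rfl⟩

/-- Stated for all large exponents, so that finitely many elements can share one power of `z`. -/
theorem exists_pow_mul_mem_of_mem_adjoin {B : Subalgebra K L} {s : Set L} {z : L} (hz : z ∈ B)
    (hs : ∀ f ∈ s, z * f ∈ B) {h : L} (hh : h ∈ Algebra.adjoin K s) :
    ∃ M : ℕ, ∀ m, M ≤ m → z ^ m * h ∈ B := by
  induction hh using Algebra.adjoin_induction with
  | mem f hf =>
    refine ⟨1, fun m hm => ?_⟩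
    obtain ⟨m, rfl⟩ := Nat.exists_eq_add_of_le' hm
    rw [pow_succ, mul_assoc]
    exact mul_mem (pow_mem hz _) (hs f hf)
  | algebraMap r => exact ⟨0, fun m _ => mul_mem (pow_mem hz _) (B.algebraMap_mem r)⟩
  | add f g _ _ hf hg =>
    obtain ⟨M, hM⟩ := hf
    obtain ⟨N, hN⟩ := hg
    refine ⟨max M N, fun m hm => ?_⟩
    rw [mul_add]
    exact add_mem (hM m (le_trans (le_max_left _ _) hm)) (hN m (le_trans (le_max_right _ _) hm))
  | mul f g _ _ hf hg =>
    obtain ⟨M, hM⟩ := hf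
    obtain ⟨N, hN⟩ := hg
    refine ⟨N + M, fun m hm => ?_⟩
    obtain ⟨m, rfl⟩ := Nat.exists_eq_add_of_le hm
    have h1 : z ^ (N + M + m) * (f * g) = (z ^ (M + m) * f) * (z ^ N * g) := by ring
    rw [h1]
    exact mul_mem (hM _ (Nat.le_add_right _ _)) (hN _ le_rfl)

/-- If `z` clears the denominators of `C` into `A`, and those of generators of an ideal of `C` into
the ideal `I` of `A`, then it clears the denominators of this ideal into `I`. -/
theorem exists_pow_mul_mem_idealImage_of_span {A C : Subalgebra K L} {z : L}
    (hzC : ∀ u ∈ C, ∃ M : ℕ, ∀ m, M ≤ m → z ^ m * u ∈ A) {I : Ideal A} {s : Set C}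
    (hs : ∀ g ∈ s, ∃ M : ℕ, ∀ m, M ≤ m → z ^ m * (g : L) ∈ idealImage I) {f : L}
    (hf : f ∈ idealImage (Ideal.span s)) :
    ∃ M : ℕ, ∀ m, M ≤ m → z ^ m * f ∈ idealImage I := by
  obtain ⟨g, hg, rfl⟩ := hf
  change g ∈ Submodule.span C s at hg
  induction hg using Submodule.span_induction with
  | mem g hg => exact hs g hg
  | zero => exact ⟨0, fun m _ => by simp⟩
  | add f g _ _ hf hg =>
    obtain ⟨M, hM⟩ := hf
    obtain ⟨N, hN⟩ := hg
    refine ⟨max M N, fun m hm => ?_⟩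
    have h := add_mem (hM m (le_trans (le_max_left _ _) hm))
      (hN m (le_trans (le_max_right _ _) hm))
    rw [← mul_add] at h
    exact h
  | smul u g _ hg =>
    obtain ⟨M, hM⟩ := hg
    obtain ⟨N, hN⟩ := hzC u u.2
    refine ⟨N + M, fun m hm => ?_⟩
    obtain ⟨m, rfl⟩ := Nat.exists_eq_add_of_le hm
    have h1 : z ^ (N + M + m) * ((u • g : C) : L) =
        (z ^ (N + m) * (u : L)) * (z ^ M * (g : L)) := by
      rw [smul_eq_mul, Subalgebra.coe_mul]; ring
    change z ^ (N + M + m) * ((u • g : C) : L) ∈ _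
    rw [h1]
    exact mul_mem_idealImage (hN _ (Nat.le_add_right _ _)) (hM _ le_rfl)

theorem exists_pow_mul_mem_idealImage {A C : Subalgebra K L} (φ : A →ₐ[K] C)
    (hφ : ∀ f, (φ f : L) = f) {z : L} (hzC : ∀ u ∈ C, ∃ M : ℕ, ∀ m, M ≤ m → z ^ m * u ∈ A)
    (I : Ideal A) {f : L} (hf : f ∈ idealImage (I.map φ)) :
    ∃ M : ℕ, ∀ m, M ≤ m → z ^ m * f ∈ idealImage I := by
  refine exists_pow_mul_mem_idealImage_of_span hzC ?_ hf
  rintro _ ⟨g, hg, rfl⟩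
  obtain ⟨M, hM⟩ := hzC 1 (one_mem _)
  refine ⟨M, fun m hm => ?_⟩
  have h := hM m hm
  rw [mul_one] at h
  change z ^ m * (φ g : L) ∈ _
  rw [hφ]
  exact mul_mem_idealImage h (coe_mem_idealImage.2 hg)

/-- The extension of the ideal `I` of `A` to the localization `A[1/ℓ]`, as a subspace of `L`. -/
def saturation {A : Subalgebra K L} (I : Ideal A) (l : A) : Submodule K L where
  carrier := {f | ∃ m : ℕ, (l : L) ^ m * f ∈ idealImage I}
  zero_mem' := ⟨0, by simp⟩
  add_mem' {f g} hf hg := by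
    obtain ⟨M, hM⟩ := hf
    obtain ⟨N, hN⟩ := hg
    refine ⟨M + N, ?_⟩
    have h : (l : L) ^ (M + N) * (f + g) =
        (l : L) ^ N * ((l : L) ^ M * f) + (l : L) ^ M * ((l : L) ^ N * g) := by ring
    rw [h]
    exact add_mem (mul_mem_idealImage (pow_mem l.2 _) hM) (mul_mem_idealImage (pow_mem l.2 _) hN)
  smul_mem' r f hf := by
    obtain ⟨M, hM⟩ := hf
    refine ⟨M, ?_⟩
    rw [mul_smul_comm]
    exact Submodule.smul_mem _ r hM

theorem idealImage_le_saturation {A : Subalgebra K L} (I : Ideal A) (l : A) :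
    idealImage I ≤ saturation I l :=
  fun f hf => ⟨0, by simpa using hf⟩

theorem saturation_mono {A : Subalgebra K L} {I J : Ideal A} (h : I ≤ J) (l : A) :
    saturation I l ≤ saturation J l := by
  rintro f ⟨m, g, hg, hgf⟩
  exact ⟨m, g, h hg, hgf⟩

theorem mul_mem_saturation {A : Subalgebra K L} {I : Ideal A} {l : A} {h f : L} {N : ℕ}
    (hh : (l : L) ^ N * h ∈ A) (hf : f ∈ saturation I l) : h * f ∈ saturation I l := by
  obtain ⟨M, hM⟩ := hf
  refine ⟨N + M, ?_⟩
  have h1 : (l : L) ^ (N + M) * (h * f) = ((l : L) ^ N * h) * ((l : L) ^ M * f) := by ring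
  rw [h1]
  exact mul_mem_idealImage hh hM

theorem mul_mem_saturation_of_mem {A : Subalgebra K L} {I : Ideal A} {l : A} {h f : L}
    (hh : h ∈ A) (hf : f ∈ saturation I l) : h * f ∈ saturation I l :=
  mul_mem_saturation (N := 0) (by simpa using hh) hf

theorem mul_pow_sub_one_mem {R : Type*} [CommRing R] {I : Ideal R} {x : R} (hx : x - 1 ∈ I)
    (m : ℕ) : x ^ m - 1 ∈ I := by
  have h := sub_dvd_pow_sub_pow x 1 m
  rw [one_pow] at h
  exact I.mem_of_dvd h hx

/-- As `l` is a unit modulo `I`, the map `A / I → A[1/l] / I[1/l]` is injective: `f = u ^ m * (l ^ m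
* f) - ((l * u) ^ m - 1) * f`. -/
theorem mem_idealImage_of_mem_saturation {A : Subalgebra K L} {I : Ideal A} {l u : A}
    (hu : l * u - 1 ∈ I) {f : L} (hf : f ∈ A) (hfs : f ∈ saturation I l) : f ∈ idealImage I := by
  obtain ⟨m, g, hg, hgf⟩ := hfs
  have h1 : g = l ^ m * ⟨f, hf⟩ := Subtype.ext hgf
  have h2 : (⟨f, hf⟩ : A) = u ^ m * g - ((l * u) ^ m - 1) * ⟨f, hf⟩ := by rw [h1]; ring
  refine ⟨⟨f, hf⟩, ?_, rfl⟩
  rw [SetLike.mem_coe, Submodule.restrictScalars_mem, h2]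
  exact I.sub_mem (I.mul_mem_left _ hg) (I.mul_mem_right _ (mul_pow_sub_one_mem hu m))

/-- The matching surjectivity of `A / I → A[1/l] / I[1/l]`: a denominator `l ^ m` is replaced by the
factor `u ^ m`. -/
theorem exists_sub_mem_saturation {A : Subalgebra K L} {I : Ideal A} {l u : A}
    (hu : l * u - 1 ∈ I) {f : L} {m : ℕ} (hf : (l : L) ^ m * f ∈ A) :
    ∃ g ∈ A, f - g ∈ saturation I l := by
  refine ⟨(u : L) ^ m * ((l : L) ^ m * f), mul_mem (pow_mem u.2 _) hf, m, ?_⟩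
  have h := I.mul_mem_left (-⟨_, hf⟩) (mul_pow_sub_one_mem hu m)
  refine ⟨_, h, ?_⟩
  change -((l : L) ^ m * f) * (((l : L) * u) ^ m - 1) = _
  ring

end Saturation

/-! ### The affine open where the linear forms `ℓ_i` do not vanish -/

section AffineRing

variable {K : Type*} [Field K] {k : ℕ} {n : Fin k → ℕ}

/-- The linear form `ℓ_i = ∑_j c_{ij} x_{ij}`. -/
def linForm (c : (i : Fin k) → Fin (n i + 1) → K) (i : Fin k) : Frac K n :=
  ∑ j, c i j • coord K n i j

/-- The function `x_{ij} / ℓ_i` on the affine open `{ℓ_i ≠ 0 for all i}`. -/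
def formCoord (c : (i : Fin k) → Fin (n i + 1) → K) (i : Fin k) (j : Fin (n i + 1)) : Frac K n :=
  coord K n i j / linForm c i

/-- The ring of functions on the affine open `{ℓ_i ≠ 0 for all i}` of `X`. -/
def affineRing (c : (i : Fin k) → Fin (n i + 1) → K) : Subalgebra K (Frac K n) :=
  Algebra.adjoin K {f | ∃ (i : Fin k) (j : Fin (n i + 1)), f = formCoord c i j}

/-- The function `∏ i, x_{i,σ(i)} / ℓ_i`. -/
def vertexCoord (c : (i : Fin k) → Fin (n i + 1) → K) (σ : Chart n) : Frac K n :=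
  ∏ i, formCoord c i (σ i)

variable (K) in
/-- The function `∏ i, x_{i,σ(i)} / x_{i,τ(i)}` on `U_τ`. -/
def transition (σ τ : Chart n) : Frac K n :=
  ∏ i, coord K n i (σ i) / coord K n i (τ i)

variable {c : (i : Fin k) → Fin (n i + 1) → K}

theorem formCoord_mem_affineRing (i : Fin k) (j : Fin (n i + 1)) :
    formCoord c i j ∈ affineRing c :=
  Algebra.subset_adjoin ⟨i, j, rfl⟩

theorem vertexCoord_mem_affineRing (σ : Chart n) : vertexCoord c σ ∈ affineRing c :=
  prod_mem fun i _ => formCoord_mem_affineRing i _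

theorem coord_div_coord_mem_chartRing (σ : Chart n) (i : Fin k) (j : Fin (n i + 1)) :
    coord K n i j / coord K n i (σ i) ∈ chartRing K n σ :=
  (affineCoord K n σ i j).2

theorem linForm_div_coord_mem_chartRing (σ : Chart n) (i : Fin k) :
    linForm c i / coord K n i (σ i) ∈ chartRing K n σ := by
  unfold linForm
  rw [Finset.sum_div]
  refine sum_mem fun j _ => ?_
  rw [smul_div_assoc]
  exact Subalgebra.smul_mem _ (coord_div_coord_mem_chartRing σ i j) _

theorem inv_vertexCoord_eq (σ : Chart n) :
    (vertexCoord c σ)⁻¹ = ∏ i, linForm c i / coord K n i (σ i) := by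
  unfold vertexCoord formCoord
  rw [← Finset.prod_inv_distrib]
  exact Finset.prod_congr rfl fun i _ => inv_div _ _

theorem inv_vertexCoord_mem_chartRing (σ : Chart n) :
    (vertexCoord c σ)⁻¹ ∈ chartRing K n σ := by
  rw [inv_vertexCoord_eq]
  exact prod_mem fun i _ => linForm_div_coord_mem_chartRing σ i

theorem vertexCoord_ne_zero (hc : ∀ i, linForm c i ≠ 0) (σ : Chart n) : vertexCoord c σ ≠ 0 :=
  Finset.prod_ne_zero_iff.2 fun i _ => div_ne_zero (coord_ne_zero K n i _) (hc i)

theorem transition_mem_chartRing (σ τ : Chart n) : transition K σ τ ∈ chartRing K n τ :=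
  prod_mem fun i _ => coord_div_coord_mem_chartRing τ i _

theorem transition_mul_vertexCoord (σ τ : Chart n) :
    transition K σ τ * vertexCoord c τ = vertexCoord c σ := by
  unfold transition vertexCoord formCoord
  rw [← Finset.prod_mul_distrib]
  refine Finset.prod_congr rfl fun i _ => ?_
  rw [div_mul_div_cancel₀ (coord_ne_zero K n i (τ i))]

theorem inv_vertexCoord_mul_vertexCoord (hc : ∀ i, linForm c i ≠ 0) (σ τ : Chart n) :
    (vertexCoord c τ)⁻¹ * vertexCoord c σ = transition K σ τ := by
  rw [← transition_mul_vertexCoord σ τ, mul_comm, mul_assoc,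
    mul_inv_cancel₀ (vertexCoord_ne_zero hc τ), mul_one]

/-- Functions on `U_σ` become regular on `{ℓ_i ≠ 0}` after multiplication by a power of
`∏ i, x_{i,σ(i)} / ℓ_i`. -/
theorem exists_vertexCoord_pow_mul_mem (σ : Chart n) {h : Frac K n} (hh : h ∈ chartRing K n σ) :
    ∃ M : ℕ, ∀ m, M ≤ m → vertexCoord c σ ^ m * h ∈ affineRing c := by
  refine exists_pow_mul_mem_of_mem_adjoin (vertexCoord_mem_affineRing σ) ?_ hh
  rintro _ ⟨i, j, rfl⟩
  unfold vertexCoord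
  rw [← Finset.mul_prod_erase _ _ (Finset.mem_univ i)]
  have h1 : formCoord c i (σ i) * (coord K n i j / coord K n i (σ i)) = formCoord c i j := by
    unfold formCoord
    rw [mul_comm, div_mul_div_cancel₀ (coord_ne_zero K n i (σ i))]
  rw [mul_right_comm, h1]
  exact mul_mem (formCoord_mem_affineRing i j) (prod_mem fun i _ => formCoord_mem_affineRing i _)

theorem exists_inv_vertexCoord_pow_mul_mem (hc : ∀ i, linForm c i ≠ 0) (σ : Chart n)
    {b : Frac K n} (hb : b ∈ affineRing c) :
    ∃ M : ℕ, ∀ m, M ≤ m → (vertexCoord c σ)⁻¹ ^ m * b ∈ chartRing K n σ := by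
  refine exists_pow_mul_mem_of_mem_adjoin (inv_vertexCoord_mem_chartRing σ) ?_ hb
  rintro _ ⟨i, j, rfl⟩
  rw [inv_vertexCoord_eq, ← Finset.mul_prod_erase _ _ (Finset.mem_univ i)]
  have h1 : linForm c i / coord K n i (σ i) * formCoord c i j =
      coord K n i j / coord K n i (σ i) := by
    unfold formCoord
    rw [mul_comm, div_mul_div_cancel₀ (hc i)]
  rw [mul_right_comm, h1]
  exact mul_mem (coord_div_coord_mem_chartRing σ i j)
    (prod_mem fun i _ => linForm_div_coord_mem_chartRing σ i)

/-- Inside `U_τ`, the overlap with `U_σ` is the locus where `transition K σ τ` is nonzero. -/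
theorem exists_transition_pow_mul_mem (σ τ : Chart n) {u : Frac K n}
    (hu : u ∈ overlapRing K n σ τ) :
    ∃ M : ℕ, ∀ m, M ≤ m → transition K σ τ ^ m * u ∈ chartRing K n τ := by
  unfold overlapRing at hu
  rw [chartRing, chartRing, ← Algebra.adjoin_union] at hu
  refine exists_pow_mul_mem_of_mem_adjoin (transition_mem_chartRing σ τ) ?_ hu
  rintro _ (⟨i, j, rfl⟩ | ⟨i, j, rfl⟩)
  · unfold transition
    rw [← Finset.mul_prod_erase _ _ (Finset.mem_univ i)]
    have h1 : coord K n i (σ i) / coord K n i (τ i) * (coord K n i j / coord K n i (σ i)) =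
        coord K n i j / coord K n i (τ i) := by
      rw [mul_comm, div_mul_div_cancel₀ (coord_ne_zero K n i (σ i))]
    rw [mul_right_comm, h1]
    exact mul_mem (coord_div_coord_mem_chartRing τ i j)
      (prod_mem fun i _ => coord_div_coord_mem_chartRing τ i _)
  · exact mul_mem (transition_mem_chartRing σ τ) (coord_div_coord_mem_chartRing τ i j)

theorem exists_transition_pow_mul_mem_idealImage (Z : ClosedSubscheme K n) (σ τ : Chart n)
    {f : Frac K n} (hf : f ∈ idealImage ((Z.ideal σ).map (resLeft K n σ τ))) :
    ∃ M : ℕ, ∀ m, M ≤ m → transition K σ τ ^ m * f ∈ idealImage (Z.ideal τ) := by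
  rw [Z.compat] at hf
  exact exists_pow_mul_mem_idealImage (resRight K n σ τ) (coe_resRight K n σ τ)
    (fun _ hu => exists_transition_pow_mul_mem σ τ hu) (Z.ideal τ) hf

theorem sum_smul_formCoord (hc : ∀ i, linForm c i ≠ 0) (i : Fin k) :
    ∑ j, c i j • formCoord c i j = 1 := by
  unfold formCoord
  simp only [← smul_div_assoc]
  rw [← Finset.sum_div]
  exact div_self (hc i)

/-- The functions `∏ i, x_{i,σ(i)} / ℓ_i` generate the unit ideal. -/
theorem span_vertexCoord_eq_top (hc : ∀ i, linForm c i ≠ 0) :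
    Ideal.span (Set.range fun σ : Chart n =>
      (⟨vertexCoord c σ, vertexCoord_mem_affineRing σ⟩ : affineRing c)) = ⊤ := by
  rw [Ideal.eq_top_iff_one]
  have h : (1 : affineRing c) = ∑ σ : Chart n, (∏ i, c i (σ i)) •
      (⟨vertexCoord c σ, vertexCoord_mem_affineRing σ⟩ : affineRing c) := by
    apply Subtype.ext
    rw [AddSubmonoidClass.coe_finsetSum]
    -- Expanding the product of the identities `∑ j, c i j • formCoord c i j = 1` gives one term per
    -- chart.
    have h1 : (1 : Frac K n) = ∏ i, ∑ j, c i j • formCoord c i j := by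
      simp [sum_smul_formCoord hc]
    rw [OneMemClass.coe_one, h1, Finset.prod_univ_sum, Fintype.piFinset_univ]
    refine Finset.sum_congr rfl fun σ _ => ?_
    rw [Finset.prod_smul]
    rfl
  rw [h]
  refine sum_mem fun σ _ => ?_
  rw [Algebra.smul_def]
  exact Ideal.mul_mem_left _ _ (Ideal.subset_span ⟨σ, rfl⟩)

/-- A partition of unity on `{ℓ_i ≠ 0}` with arbitrarily high powers, used to glue functions given
on the charts. -/
theorem exists_sum_mul_vertexCoord_pow (hc : ∀ i, linForm c i ≠ 0) (M : ℕ) :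
    ∃ b : Chart n → Frac K n, (∀ σ, b σ ∈ affineRing c) ∧
      ∑ σ, b σ * vertexCoord c σ ^ M = 1 := by
  have h := Ideal.span_pow_eq_top _ (span_vertexCoord_eq_top hc) M
  rw [Ideal.eq_top_iff_one, ← Set.range_comp] at h
  obtain ⟨b, hb⟩ := (Ideal.mem_span_range_iff_exists_fun).1 h
  refine ⟨fun σ => b σ, fun σ => (b σ).2, ?_⟩
  have h1 := congrArg (fun x : affineRing c => (x : Frac K n)) hb
  simpa using h1

end AffineRing

/-! ### `H¹(X, 𝓘_Z(a))` as functions on `Z` modulo restrictions of sections -/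

section Comparison

variable {K : Type*} [Field K] {k : ℕ} {n : Fin k → ℕ}

/-- The function `∏ i, ℓ_i / x_{i,σ(i)}` on `U_σ`. -/
def formRatio (c : (i : Fin k) → Fin (n i + 1) → K) (σ : Chart n) : chartRing K n σ :=
  ⟨(vertexCoord c σ)⁻¹, inv_vertexCoord_mem_chartRing σ⟩

/-- The section `∏ i, ℓ_i ^ a_i` of `𝒪_X(a)`. -/
def formMonomial (c : (i : Fin k) → Fin (n i + 1) → K) (a : Fin k → ℕ) : Frac K n :=
  ∏ i, linForm c i ^ a i

/-- The linear forms `ℓ_i` do not vanish anywhere on `Z`. -/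
def ClosedSubscheme.IsUnitOn (Z : ClosedSubscheme K n) (c : (i : Fin k) → Fin (n i + 1) → K) :
    Prop :=
  ∀ σ, ∃ u, formRatio c σ * u - 1 ∈ Z.ideal σ

/-- The ideal of `Z` in the coordinate ring of the affine open `{ℓ_i ≠ 0 for all i}`. -/
def ClosedSubscheme.affineIdeal (Z : ClosedSubscheme K n)
    {c : (i : Fin k) → Fin (n i + 1) → K} (hc : ∀ i, linForm c i ≠ 0) :
    Ideal (affineRing c) where
  carrier := {b | ∀ σ, (b : Frac K n) ∈ saturation (Z.ideal σ) (formRatio c σ)}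
  zero_mem' σ := zero_mem (saturation (Z.ideal σ) (formRatio c σ))
  add_mem' ha hb σ := add_mem (ha σ) (hb σ)
  smul_mem' b f hf σ := by
    obtain ⟨M, hM⟩ := exists_inv_vertexCoord_pow_mul_mem hc σ b.2
    exact mul_mem_saturation (hM M le_rfl) (hf σ)

/-- The functions `s / ∏ i, ℓ_i ^ a_i` for the global sections `s` of `𝒪_X(a)`. -/
def formSections (c : (i : Fin k) → Fin (n i + 1) → K) (a : Fin k → ℕ) :
    Submodule K (affineRing c) :=
  (globalSections K n a).comap
    (LinearMap.mulLeft K (formMonomial c a) ∘ₗ (affineRing c).val.toLinearMap)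

variable {c : (i : Fin k) → Fin (n i + 1) → K} {Z : ClosedSubscheme K n}

theorem mem_formSections {a : Fin k → ℕ} {b : affineRing c} :
    b ∈ formSections c a ↔ formMonomial c a * (b : Frac K n) ∈ globalSections K n a :=
  Iff.rfl

theorem formMonomial_ne_zero (hc : ∀ i, linForm c i ≠ 0) (a : Fin k → ℕ) :
    formMonomial c a ≠ 0 :=
  Finset.prod_ne_zero_iff.2 fun i _ => pow_ne_zero _ (hc i)

theorem chartMonomial_div_formMonomial (a : Fin k → ℕ) (σ : Chart n) :
    chartMonomial K n a σ / formMonomial c a = ∏ i, formCoord c i (σ i) ^ a i := by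
  unfold chartMonomial formMonomial formCoord
  rw [← Finset.prod_div_distrib]
  exact Finset.prod_congr rfl fun i _ => (div_pow _ _ _).symm

theorem chartMonomial_div_formMonomial_mem (a : Fin k → ℕ) (σ : Chart n) :
    chartMonomial K n a σ / formMonomial c a ∈ affineRing c := by
  rw [chartMonomial_div_formMonomial]
  exact prod_mem fun i _ => pow_mem (formCoord_mem_affineRing i _) _

theorem formMonomial_div_chartMonomial_mem (a : Fin k → ℕ) (σ : Chart n) :
    formMonomial c a / chartMonomial K n a σ ∈ chartRing K n σ := by
  have h : formMonomial c a / chartMonomial K n a σ =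
      ∏ i, (linForm c i / coord K n i (σ i)) ^ a i := by
    unfold chartMonomial formMonomial
    rw [← Finset.prod_div_distrib]
    exact Finset.prod_congr rfl fun i _ => (div_pow _ _ _).symm
  rw [h]
  exact prod_mem fun i _ => pow_mem (linForm_div_coord_mem_chartRing σ i) _

/-- On each chart a power of `vertexCoord c σ` clears the denominators; the partition of unity
combines the charts. -/
theorem div_formMonomial_mem_affineRing (hc : ∀ i, linForm c i ≠ 0) {a : Fin k → ℕ}
    {s : Frac K n} (hs : s ∈ globalSections K n a) : s / formMonomial c a ∈ affineRing c := by
  have h : ∀ σ : Chart n, ∃ M : ℕ, ∀ m, M ≤ m →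
      vertexCoord c σ ^ m * (s / formMonomial c a) ∈ affineRing c := by
    intro σ
    obtain ⟨M, hM⟩ := exists_vertexCoord_pow_mul_mem (c := c) σ
      (mem_sections_emptyScheme.1 (globalSections_le_sections a σ hs))
    refine ⟨M, fun m hm => ?_⟩
    have h1 := mul_mem (chartMonomial_div_formMonomial_mem (c := c) a σ) (hM m hm)
    have h2 : chartMonomial K n a σ / formMonomial c a *
        (vertexCoord c σ ^ m * (s / chartMonomial K n a σ)) =
        vertexCoord c σ ^ m * (s / formMonomial c a) := by
      field_simp [chartMonomial_ne_zero (K := K) a σ, formMonomial_ne_zero hc a]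
    rwa [h2] at h1
  choose M hM using h
  obtain ⟨b, hb, hb1⟩ := exists_sum_mul_vertexCoord_pow hc (Finset.univ.sup M)
  rw [← one_mul (s / _), ← hb1, Finset.sum_mul]
  refine sum_mem fun σ _ => ?_
  rw [mul_assoc]
  exact mul_mem (hb σ) (hM σ _ (Finset.le_sup (Finset.mem_univ σ)))

/-- Because the `ℓ_i` are units on `Z`, membership in the ideal may be tested after inverting them.
-/
theorem mem_sections_iff_div_mem_saturation (hc : ∀ i, linForm c i ≠ 0) (hZ : Z.IsUnitOn c)
    {a : Fin k → ℕ} {σ : Chart n} {g : Frac K n} (hg : g ∈ (emptyScheme K n).sections a σ) :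
    g ∈ Z.sections a σ ↔ g / formMonomial c a ∈ saturation (Z.ideal σ) (formRatio c σ) := by
  have hx := chartMonomial_ne_zero (K := K) a σ
  have hl := formMonomial_ne_zero hc a
  have h0 : g ∈ Z.sections a σ ↔ g / chartMonomial K n a σ ∈ idealImage (Z.ideal σ) :=
    mem_scaledIdeal_iff_div hx
  rw [h0]
  constructor
  · intro h
    obtain ⟨M, hM⟩ := exists_inv_vertexCoord_pow_mul_mem hc σ
      (chartMonomial_div_formMonomial_mem (c := c) a σ)
    have h1 := mul_mem_saturation (l := formRatio c σ) (hM M le_rfl)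
      (idealImage_le_saturation _ _ h)
    rwa [div_mul_div_comm, mul_comm, mul_div_mul_right _ _ hx] at h1
  · intro h
    have h1 := mul_mem_saturation_of_mem (formMonomial_div_chartMonomial_mem (c := c) a σ) h
    rw [div_mul_div_comm, mul_comm, mul_div_mul_right _ _ hl] at h1
    obtain ⟨u, hu⟩ := hZ σ
    exact mem_idealImage_of_mem_saturation hu (mem_sections_emptyScheme.1 hg) h1

theorem idealImage_le_overlap_left (σ τ : Chart n) :
    idealImage (Z.ideal σ) ≤ idealImage ((Z.ideal σ).map (resLeft K n σ τ)) := by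
  rintro _ ⟨g, hg, rfl⟩
  exact ⟨resLeft K n σ τ g, Ideal.mem_map_of_mem _ hg, coe_resLeft K n σ τ g⟩

theorem idealImage_le_overlap_right (σ τ : Chart n) :
    idealImage (Z.ideal τ) ≤ idealImage ((Z.ideal σ).map (resLeft K n σ τ)) := by
  rw [Z.compat]
  rintro _ ⟨g, hg, rfl⟩
  exact ⟨resRight K n σ τ g, Ideal.mem_map_of_mem _ hg, coe_resRight K n σ τ g⟩

theorem mem_overlapSections_of_div_mem_saturation (hc : ∀ i, linForm c i ≠ 0)
    (hZ : Z.IsUnitOn c) {a : Fin k → ℕ} {σ τ : Chart n} {f g : Frac K n}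
    (hfg : f - g ∈ (emptyScheme K n).overlapSections a σ τ) {b : Frac K n}
    (hf : b - f / formMonomial c a ∈ saturation (Z.ideal τ) (formRatio c τ))
    (hg : b - g / formMonomial c a ∈ saturation (Z.ideal σ) (formRatio c σ)) :
    f - g ∈ Z.overlapSections a σ τ := by
  have hx := chartMonomial_ne_zero (K := K) a σ
  have hl := formMonomial_ne_zero hc a
  let I := (Z.ideal σ).map (resLeft K n σ τ)
  let l := resLeft K n σ τ (formRatio c σ)
  have hlcoe : (l : Frac K n) = (vertexCoord c σ)⁻¹ := coe_resLeft K n σ τ _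
  have h1 : b - g / formMonomial c a ∈ saturation I l := by
    obtain ⟨m, hm⟩ := hg
    refine ⟨m, ?_⟩
    rw [hlcoe]
    exact idealImage_le_overlap_left σ τ hm
  have h2 : b - f / formMonomial c a ∈ saturation I l := by
    obtain ⟨m, hm⟩ := hf
    refine ⟨m, ?_⟩
    -- On the overlap, powers of `formRatio c σ` are multiples of powers of `formRatio c τ`, so the
    -- condition over `U_τ` transfers to the saturation by `l`.
    have h3 : (vertexCoord c σ)⁻¹ = transition K τ σ * (vertexCoord c τ)⁻¹ := by
      rw [← inv_vertexCoord_mul_vertexCoord hc τ σ, mul_assoc,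
        mul_inv_cancel₀ (vertexCoord_ne_zero hc τ), mul_one]
    rw [hlcoe, h3, mul_pow, mul_assoc]
    refine mul_mem_idealImage (pow_mem ?_ _) (idealImage_le_overlap_right σ τ hm)
    exact (le_sup_left : chartRing K n σ ≤ _) (transition_mem_chartRing τ σ)
  have h3 := sub_mem h1 h2
  rw [sub_sub_sub_cancel_left, ← sub_div] at h3
  have h4 := mul_mem_saturation_of_mem (I := I) (l := l)
    ((le_sup_left : chartRing K n σ ≤ _) (formMonomial_div_chartMonomial_mem (c := c) a σ)) h3
  rw [div_mul_div_comm, mul_comm, mul_div_mul_right _ _ hl] at h4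
  obtain ⟨u, hu⟩ := hZ σ
  have h5 : l * resLeft K n σ τ u - 1 ∈ I := by
    have h := Ideal.mem_map_of_mem (resLeft K n σ τ) hu
    rwa [map_sub, map_mul, map_one] at h
  exact (mem_scaledIdeal_iff_div hx).2
    (mem_idealImage_of_mem_saturation h5 (mem_overlapSections_emptyScheme.1 hfg) h4)

/-- Pairs of a function `b` on the affine open `{ℓ_i ≠ 0 for all i}` and a `0`-cochain of
`𝒪_X(a)` that induces the restriction of `b · ∏ i, ℓ_i ^ a_i` to `Z`. -/
def liftPairs (Z : ClosedSubscheme K n) (c : (i : Fin k) → Fin (n i + 1) → K)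
    (a : Fin k → ℕ) : Submodule K (affineRing c × (Chart n → Frac K n)) where
  carrier := {p | ∀ σ, p.2 σ ∈ (emptyScheme K n).sections a σ ∧
    (p.1 : Frac K n) - p.2 σ / formMonomial c a ∈ saturation (Z.ideal σ) (formRatio c σ)}
  zero_mem' σ := by
    refine ⟨zero_mem _, ?_⟩
    simp
  add_mem' {p q} hp hq σ := by
    refine ⟨add_mem (hp σ).1 (hq σ).1, ?_⟩
    have h := add_mem (hp σ).2 (hq σ).2
    rw [sub_add_sub_comm, ← add_div] at h
    exact h
  smul_mem' r p hp σ := by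
    refine ⟨Submodule.smul_mem _ r (hp σ).1, ?_⟩
    have h := Submodule.smul_mem _ r (hp σ).2
    rw [smul_sub, ← smul_div_assoc] at h
    exact h

theorem cechD0_mem_cocycle1_of_mem_liftPairs (hc : ∀ i, linForm c i ≠ 0) (hZ : Z.IsUnitOn c)
    {a : Fin k → ℕ} {p : affineRing c × (Chart n → Frac K n)} (hp : p ∈ liftPairs Z c a) :
    cechD0 K n p.2 ∈ Z.cocycle1 a := by
  have h := (emptyScheme K n).coboundary1_le_cocycle1 a ⟨p.2, fun σ _ => (hp σ).1, rfl⟩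
  refine ⟨fun σ _ τ _ => ?_, h.2⟩
  exact mem_overlapSections_of_div_mem_saturation hc hZ (h.1 σ trivial τ trivial)
    (hp τ).2 (hp σ).2

/-- The connecting map from `liftPairs` to `H¹(X, 𝓘_Z(a))`. -/
def connecting (hc : ∀ i, linForm c i ≠ 0) (hZ : Z.IsUnitOn c) (a : Fin k → ℕ) :
    liftPairs Z c a →ₗ[K] Z.H1 a :=
  Submodule.mkQ _ ∘ₗ LinearMap.codRestrict (Z.cocycle1 a)
    (cechD0 K n ∘ₗ LinearMap.snd K _ _ ∘ₗ (liftPairs Z c a).subtype)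
    fun p => cechD0_mem_cocycle1_of_mem_liftPairs hc hZ p.2

theorem connecting_eq_zero_iff (hc : ∀ i, linForm c i ≠ 0) (hZ : Z.IsUnitOn c)
    {a : Fin k → ℕ} (p : liftPairs Z c a) :
    connecting hc hZ a p = 0 ↔ cechD0 K n p.1.2 ∈ Z.coboundary1 a := by
  unfold connecting
  rw [LinearMap.comp_apply, Submodule.mkQ_apply, Submodule.Quotient.mk_eq_zero]
  rfl

/-- A cocycle of `𝓘_Z(a)` is the coboundary of a cochain `g` of `𝒪_X(a)`. The `g σ` agree on `Z`
over overlaps, and the partition of unity glues them to a function `f` on `{ℓ_i ≠ 0}` with the same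
restrictions to `Z`. -/
theorem connecting_surjective (hc : ∀ i, linForm c i ≠ 0) (hZ : Z.IsUnitOn c)
    (a : Fin k → ℕ) : Function.Surjective (connecting (Z := Z) hc hZ a) := by
  intro y
  obtain ⟨⟨x, hx⟩, rfl⟩ := Submodule.mkQ_surjective _ y
  obtain ⟨g, hg, rfl⟩ := cocycle1_emptyScheme_le_coboundary1 a
    (cocycle1_le_cocycle1_emptyScheme Z a hx)
  have hl := formMonomial_ne_zero hc a
  have h1 : ∀ σ : Chart n, ∃ M : ℕ, ∀ m, M ≤ m →
      vertexCoord c σ ^ m * (g σ / formMonomial c a) ∈ affineRing c := by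
    intro σ
    obtain ⟨M, hM⟩ := exists_vertexCoord_pow_mul_mem (c := c) σ
      (mem_sections_emptyScheme.1 (hg σ trivial))
    refine ⟨M, fun m hm => ?_⟩
    have h1 := mul_mem (chartMonomial_div_formMonomial_mem (c := c) a σ) (hM m hm)
    have h2 : chartMonomial K n a σ / formMonomial c a *
        (vertexCoord c σ ^ m * (g σ / chartMonomial K n a σ)) =
        vertexCoord c σ ^ m * (g σ / formMonomial c a) := by
      field_simp [chartMonomial_ne_zero (K := K) a σ, hl]
    rwa [h2] at h1
  have h2 : ∀ σ τ : Chart n, ∃ M : ℕ, ∀ m, M ≤ m →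
      vertexCoord c σ ^ m * ((g σ - g τ) / formMonomial c a) ∈
        saturation (Z.ideal τ) (formRatio c τ) := by
    intro σ τ
    have h3 : (g τ - g σ) / chartMonomial K n a σ ∈
        idealImage ((Z.ideal σ).map (resLeft K n σ τ)) :=
      (mem_scaledIdeal_iff_div (chartMonomial_ne_zero a σ)).1 (hx.1 σ trivial τ trivial)
    obtain ⟨M, hM⟩ := exists_transition_pow_mul_mem_idealImage Z σ τ h3
    refine ⟨M, fun m hm => ?_⟩
    have h4 : vertexCoord c σ ^ m * ((g τ - g σ) / chartMonomial K n a σ) ∈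
        saturation (Z.ideal τ) (formRatio c τ) := by
      refine ⟨m, ?_⟩
      change (vertexCoord c τ)⁻¹ ^ m * _ ∈ _
      rw [← mul_assoc, ← mul_pow, inv_vertexCoord_mul_vertexCoord hc]
      exact hM m hm
    obtain ⟨N, hN⟩ := exists_inv_vertexCoord_pow_mul_mem hc τ
      (neg_mem (chartMonomial_div_formMonomial_mem (c := c) a σ))
    have h5 := mul_mem_saturation (l := formRatio c τ) (hN N le_rfl) h4
    have h6 : -(chartMonomial K n a σ / formMonomial c a) *
        (vertexCoord c σ ^ m * ((g τ - g σ) / chartMonomial K n a σ)) =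
        vertexCoord c σ ^ m * ((g σ - g τ) / formMonomial c a) := by
      have := chartMonomial_ne_zero (K := K) a σ
      field_simp
      ring
    rwa [h6] at h5
  choose M hM using h1
  choose N hN using h2
  -- One exponent that makes all local terms regular and all their differences vanish on `Z`.
  let R := Finset.univ.sup M + Finset.univ.sup fun p : Chart n × Chart n => N p.1 p.2
  have hRM : ∀ σ, M σ ≤ R := fun σ =>
    (Finset.le_sup (Finset.mem_univ σ)).trans (Nat.le_add_right _ _)
  have hRN : ∀ σ τ, N σ τ ≤ R := fun σ τ =>
    (Finset.le_sup (f := fun p : Chart n × Chart n => N p.1 p.2)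
      (Finset.mem_univ (σ, τ))).trans (Nat.le_add_left _ _)
  obtain ⟨b, hb, hb1⟩ := exists_sum_mul_vertexCoord_pow hc R
  let f : Frac K n := ∑ σ, b σ * (vertexCoord c σ ^ R * (g σ / formMonomial c a))
  have hf : f ∈ affineRing c := sum_mem fun σ _ => mul_mem (hb σ) (hM σ R (hRM σ))
  have hp : ((⟨f, hf⟩ : affineRing c), g) ∈ liftPairs Z c a := by
    intro τ
    refine ⟨hg τ trivial, ?_⟩
    have h3 : f - g τ / formMonomial c a =
        ∑ σ, b σ * (vertexCoord c σ ^ R * ((g σ - g τ) / formMonomial c a)) := by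
      rw [← one_mul (g τ / _), ← hb1, Finset.sum_mul, ← Finset.sum_sub_distrib]
      refine Finset.sum_congr rfl fun σ _ => ?_
      ring
    change f - g τ / formMonomial c a ∈ _
    rw [h3]
    refine sum_mem fun σ _ => ?_
    obtain ⟨m, hm⟩ := exists_inv_vertexCoord_pow_mul_mem hc τ (hb σ)
    exact mul_mem_saturation (l := formRatio c τ) (hm m le_rfl) (hN σ τ R (hRN σ τ))
  exact ⟨⟨_, hp⟩, rfl⟩

/-- Over `U_σ` the denominators of `b` are powers of `formRatio c σ`, a unit on `Z`, so the
restriction of `b` to `Z ∩ U_σ` lifts to `U_σ`. -/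
theorem exists_mem_liftPairs (hc : ∀ i, linForm c i ≠ 0) (hZ : Z.IsUnitOn c)
    (a : Fin k → ℕ) (b : affineRing c) : ∃ g, (b, g) ∈ liftPairs Z c a := by
  have hl := formMonomial_ne_zero hc a
  have h : ∀ σ, ∃ g ∈ (emptyScheme K n).sections a σ,
      (b : Frac K n) - g / formMonomial c a ∈ saturation (Z.ideal σ) (formRatio c σ) := by
    intro σ
    obtain ⟨u, hu⟩ := hZ σ
    obtain ⟨M, hM⟩ := exists_inv_vertexCoord_pow_mul_mem hc σ b.2
    obtain ⟨h, hh, hbh⟩ := exists_sub_mem_saturation hu (hM M le_rfl)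
    refine ⟨formMonomial c a * h, mem_sections_emptyScheme.2 ?_, ?_⟩
    · rw [mul_div_right_comm]
      exact mul_mem (formMonomial_div_chartMonomial_mem a σ) hh
    · rwa [mul_div_cancel_left₀ _ hl]
  choose g hg using h
  exact ⟨g, hg⟩

/-- If `dg = dh` with `h` a cochain of `𝓘_Z(a)`, the differences `g σ - h σ` glue to a global
section with the same restriction to `Z` as `b`. Conversely, subtracting such a section moves `g`
into `𝓘_Z(a)` without changing `dg`. -/
theorem cechD0_mem_coboundary1_iff (hc : ∀ i, linForm c i ≠ 0) (hZ : Z.IsUnitOn c)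
    {a : Fin k → ℕ} {p : affineRing c × (Chart n → Frac K n)} (hp : p ∈ liftPairs Z c a) :
    cechD0 K n p.2 ∈ Z.coboundary1 a ↔
      p.1 ∈ formSections c a ⊔ (Z.affineIdeal hc).restrictScalars K := by
  have hl := formMonomial_ne_zero hc a
  obtain ⟨b, g⟩ := p
  constructor
  · rintro ⟨h, hh, hhg⟩
    have hconst : ∀ σ τ, g σ - h σ = g τ - h τ := by
      intro σ τ
      have h1 : h τ - h σ = g τ - g σ := congrFun (congrFun hhg σ) τ
      linear_combination h1
    let σ₀ : Chart n := fun _ => 0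
    have hs : g σ₀ - h σ₀ ∈ globalSections K n a := by
      refine mem_globalSections_of_forall_mem_sections fun σ => ?_
      rw [hconst σ₀ σ]
      exact sub_mem (hp σ).1 (sections_le_sections_emptyScheme Z a σ (hh σ trivial))
    let v : affineRing c := ⟨_, div_formMonomial_mem_affineRing hc hs⟩
    have hv : v ∈ formSections c a := by
      rw [mem_formSections, mul_div_cancel₀ _ hl]
      exact hs
    have hbv : b - v ∈ Z.affineIdeal hc := by
      intro σ
      have h1 := (mem_sections_iff_div_mem_saturation hc hZ
        (sections_le_sections_emptyScheme Z a σ (hh σ trivial))).1 (hh σ trivial)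
      have h2 := add_mem (hp σ).2 h1
      have h3 : ((b - v : affineRing c) : Frac K n) =
          b - g σ / formMonomial c a + h σ / formMonomial c a := by
        change (b : Frac K n) - (g σ₀ - h σ₀) / formMonomial c a = _
        rw [hconst σ₀ σ]
        ring
      rw [h3]
      exact h2
    exact Submodule.mem_sup.2 ⟨v, hv, b - v, hbv, by abel⟩
  · intro hb
    obtain ⟨v, hv, j, hj, hvj⟩ := Submodule.mem_sup.1 hb
    have hvj' : (b : Frac K n) = v + j := by rw [← Subalgebra.coe_add, hvj]
    let s := formMonomial c a * (v : Frac K n)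
    have hs : s ∈ globalSections K n a := hv
    refine ⟨fun σ => g σ - s, fun σ _ => ?_, ?_⟩
    · have h1 : g σ - s ∈ (emptyScheme K n).sections a σ :=
        sub_mem (hp σ).1 (globalSections_le_sections a σ hs)
      refine (mem_sections_iff_div_mem_saturation hc hZ h1).2 ?_
      have h2 := sub_mem (hj σ) (hp σ).2
      have h3 : (g σ - s) / formMonomial c a =
          (j : Frac K n) - (b - g σ / formMonomial c a) := by
        rw [sub_div, mul_div_cancel_left₀ _ hl, hvj']
        ring
      rw [h3]
      exact h2
    · funext σ τ
      exact sub_sub_sub_cancel_right _ _ _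

/-- `H¹(X, 𝓘_Z(a))` is the cokernel of the restriction of the sections of `𝒪_X(a)` to `Z`. -/
theorem nonempty_quotient_equiv_H1 (hc : ∀ i, linForm c i ≠ 0) (hZ : Z.IsUnitOn c)
    (a : Fin k → ℕ) :
    Nonempty ((affineRing c ⧸ (formSections c a ⊔ (Z.affineIdeal hc).restrictScalars K)) ≃ₗ[K]
      Z.H1 a) := by
  let ψ : liftPairs Z c a →ₗ[K]
      affineRing c ⧸ (formSections c a ⊔ (Z.affineIdeal hc).restrictScalars K) :=
    Submodule.mkQ _ ∘ₗ LinearMap.fst K _ _ ∘ₗ (liftPairs Z c a).subtype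
  have hψ : Function.Surjective ψ := by
    intro y
    obtain ⟨b, rfl⟩ := Submodule.mkQ_surjective _ y
    obtain ⟨g, hg⟩ := exists_mem_liftPairs hc hZ a b
    exact ⟨⟨_, hg⟩, rfl⟩
  -- Both maps out of `liftPairs` are surjective, so equal kernels identify their targets.
  have hker : LinearMap.ker ψ = LinearMap.ker (connecting hc hZ a) := by
    ext p
    rw [LinearMap.mem_ker, LinearMap.mem_ker, connecting_eq_zero_iff,
      cechD0_mem_coboundary1_iff hc hZ p.2]
    exact Submodule.Quotient.mk_eq_zero _
  exact ⟨(ψ.quotKerEquivOfSurjective hψ).symm.trans ((Submodule.quotEquivOfEq _ _ hker).trans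
    ((connecting hc hZ a).quotKerEquivOfSurjective (connecting_surjective hc hZ a)))⟩

end Comparison

/-! ### Finite-dimensional quotients and common eigenfunctionals -/

section LinearAlgebra

variable {K E : Type*} [Field K] [AddCommGroup E] [Module K E]

theorem finite_range_of_le_ker {F : Type*} [AddCommGroup F] [Module K F] (φ : E →ₗ[K] F)
    {M : Submodule K E} [Module.Finite K (E ⧸ M)] (h : M ≤ LinearMap.ker φ) :
    Module.Finite K (LinearMap.range φ) := by
  rw [← Submodule.range_liftQ M φ h]
  infer_instance

theorem finite_quotient_of_forall {ι : Type*} [Finite ι] {F : ι → Type*}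
    [∀ i, AddCommGroup (F i)] [∀ i, Module K (F i)] (θ : (i : ι) → E →ₗ[K] F i)
    (R : (i : ι) → Submodule K (F i)) (hfin : ∀ i, Module.Finite K (R i))
    (hR : ∀ i x, θ i x ∈ R i) {M : Submodule K E} (hM : ∀ x, (∀ i, θ i x = 0) → x ∈ M) :
    Module.Finite K (E ⧸ M) := by
  let Θ : E →ₗ[K] (i : ι) → R i := LinearMap.pi fun i => LinearMap.codRestrict _ (θ i) (hR i)
  have : Module.Finite K (E ⧸ LinearMap.ker Θ) := Module.Finite.equiv Θ.quotKerEquivRange.symm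
  have h : LinearMap.ker Θ ≤ M := fun x hx =>
    hM x fun i => congrArg Subtype.val (congrFun (LinearMap.mem_ker.1 hx) i)
  exact Module.Finite.of_surjective (Submodule.factor h) (Submodule.factor_surjective h)

theorem finite_quotient_of_le {M N : Submodule K E} [Module.Finite K (E ⧸ M)] (h : M ≤ N) :
    Module.Finite K (E ⧸ N) :=
  Module.Finite.of_surjective (Submodule.factor h) (Submodule.factor_surjective h)

theorem finrank_quotient_le_of_le {M N : Submodule K E} [Module.Finite K (E ⧸ M)] (h : M ≤ N) :
    Module.finrank K (E ⧸ N) ≤ Module.finrank K (E ⧸ M) :=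
  LinearMap.finrank_le_finrank_of_surjective (Submodule.factor_surjective h)

theorem eq_of_le_of_finrank_quotient_eq {M N : Submodule K E} [Module.Finite K (E ⧸ M)]
    (h : M ≤ N) (hr : Module.finrank K (E ⧸ M) = Module.finrank K (E ⧸ N)) : M = N := by
  have := finite_quotient_of_le h
  have hinj : Function.Injective (Submodule.factor h) :=
    (LinearMap.injective_iff_surjective_of_finrank_eq_finrank hr).2 (Submodule.factor_surjective h)
  refine le_antisymm h fun x hx => ?_
  rw [← Submodule.Quotient.mk_eq_zero]
  apply hinj
  rw [map_zero]
  exact (Submodule.Quotient.mk_eq_zero N).2 hx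

theorem finrank_quotient_pos_iff {M : Submodule K E} [Module.Finite K (E ⧸ M)] :
    0 < Module.finrank K (E ⧸ M) ↔ M ≠ ⊤ := by
  rw [Module.finrank_pos_iff, Submodule.Quotient.nontrivial_iff]

/-- Commuting endomorphisms of a nonzero finite-dimensional quotient have a common eigenvector in
the dual space. -/
theorem exists_le_forall_sub_smul_mem [IsAlgClosed K] {ι : Type*} [Finite ι]
    (f : ι → E →ₗ[K] E) (hf : ∀ i j x, f i (f j x) = f j (f i x)) (M : Submodule K E)
    [Module.Finite K (E ⧸ M)] (hM : M ≠ ⊤) (hfM : ∀ i, ∀ x ∈ M, f i x ∈ M) :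
    ∃ (μ : ι → K) (W : Submodule K E), M ≤ W ∧ W ≠ ⊤ ∧ ∀ i x, f i x - μ i • x ∈ W := by
  classical
  have := Fintype.ofFinite ι
  have h : ∀ s : Finset ι, ∃ (μ : ι → K) (W : Submodule K E), M ≤ W ∧ W ≠ ⊤ ∧
      (∀ i, ∀ x ∈ W, f i x ∈ W) ∧ ∀ i ∈ s, ∀ x, f i x - μ i • x ∈ W := by
    intro s
    induction s using Finset.induction_on with
    | empty => exact ⟨0, M, le_rfl, hM, hfM, by simp⟩
    | insert j s hj ih =>
      obtain ⟨μ, W, hMW, hW, hfW, hμ⟩ := ih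
      have := finite_quotient_of_le hMW
      have : Nontrivial (E ⧸ W) := Submodule.Quotient.nontrivial_iff.2 hW
      let g : Module.End K (E ⧸ W) := W.mapQ W (f j) (hfW j)
      obtain ⟨r, hr⟩ := Module.End.exists_eigenvalue g
      obtain ⟨v, hv⟩ := hr.exists_hasEigenvector
      let d : E →ₗ[K] E := f j - r • LinearMap.id
      -- Adding the image of `f j - r` makes `f j` act as `r`. The sum stays proper: otherwise `g -
      -- r` would be surjective, hence injective, on the finite-dimensional `E ⧸ W`, against its
      -- eigenvector `v`.
      refine ⟨Function.update μ j r, W ⊔ LinearMap.range d, hMW.trans le_sup_left, ?_, ?_, ?_⟩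
      · intro htop
        have hsurj : Function.Surjective (g - r • LinearMap.id : (E ⧸ W) →ₗ[K] (E ⧸ W)) := by
          intro y
          obtain ⟨x, rfl⟩ := Submodule.mkQ_surjective W y
          have hx : x ∈ W ⊔ LinearMap.range d := htop ▸ Submodule.mem_top
          obtain ⟨w, hw, _, ⟨z, rfl⟩, rfl⟩ := Submodule.mem_sup.1 hx
          refine ⟨W.mkQ z, ?_⟩
          have h0 : W.mkQ w = 0 := (Submodule.Quotient.mk_eq_zero W).2 hw
          rw [map_add, h0, zero_add]
          rfl
        have hinj := LinearMap.injective_iff_surjective.2 hsurj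
        apply hv.2
        apply hinj
        rw [map_zero, LinearMap.sub_apply, hv.apply_eq_smul]
        simp
      · intro i x hx
        obtain ⟨w, hw, _, ⟨z, rfl⟩, rfl⟩ := Submodule.mem_sup.1 hx
        rw [map_add]
        refine Submodule.add_mem_sup (hfW i w hw) ⟨f i z, ?_⟩
        simp [d, hf i j]
      · intro i hi x
        by_cases hij : i = j
        · subst hij
          refine Submodule.mem_sup_right ⟨x, ?_⟩
          simp [d]
        · rw [Function.update_of_ne hij]
          exact Submodule.mem_sup_left (hμ i (Finset.mem_of_mem_insert_of_ne hi hij) x)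
  obtain ⟨μ, W, h1, h2, -, h3⟩ := h Finset.univ
  exact ⟨μ, W, h1, h2, fun i => h3 i (Finset.mem_univ i)⟩

end LinearAlgebra

/-! ### Finiteness of the coordinate ring of `Z` and linear forms avoiding `Z` -/

section Finiteness

variable {K : Type*} [Field K] {k : ℕ} {n : Fin k → ℕ}
  {c : (i : Fin k) → Fin (n i + 1) → K} {Z : ClosedSubscheme K n}

instance finiteType_chartRing (σ : Chart n) : Algebra.FiniteType K (chartRing K n σ) := by
  rw [← Subalgebra.fg_iff_finiteType, Subalgebra.fg_def]
  refine ⟨_, ?_, rfl⟩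
  refine (Set.finite_range fun v : (Σ i : Fin k, Fin (n i + 1)) =>
    coord K n v.1 v.2 / coord K n v.1 (σ v.1)).subset ?_
  rintro _ ⟨i, j, rfl⟩
  exact ⟨⟨i, j⟩, rfl⟩

theorem ClosedSubscheme.IsZeroDimensional.finite (hZ : Z.IsZeroDimensional) (σ : Chart n) :
    Module.Finite K (chartRing K n σ ⧸ Z.ideal σ) := by
  rw [Module.finite_iff_krullDimLE_zero, Ring.krullDimLE_iff]
  exact hZ σ

/-- The coordinate ring of a zero-dimensional scheme is finite-dimensional. -/
theorem finite_quotient_affineIdeal (hc : ∀ i, linForm c i ≠ 0) (hZ : Z.IsZeroDimensional)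
    (hu : Z.IsUnitOn c) :
    Module.Finite K (affineRing c ⧸ (Z.affineIdeal hc).restrictScalars K) := by
  let S : Chart n → Submodule K (Frac K n) := fun σ => saturation (Z.ideal σ) (formRatio c σ)
  let φ : (σ : Chart n) → chartRing K n σ →ₗ[K] Frac K n ⧸ S σ := fun σ =>
    (S σ).mkQ ∘ₗ (chartRing K n σ).val.toLinearMap
  have hfin : ∀ σ, Module.Finite K (LinearMap.range (φ σ)) := by
    intro σ
    have : Module.Finite K (chartRing K n σ ⧸ (Z.ideal σ).restrictScalars K) := hZ.finite σ
    refine finite_range_of_le_ker (M := (Z.ideal σ).restrictScalars K) (φ σ) fun f hf => ?_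
    exact LinearMap.mem_ker.2 ((Submodule.Quotient.mk_eq_zero _).2
      (idealImage_le_saturation _ _ ⟨f, hf, rfl⟩))
  -- Over each chart, a function on `{ℓ_i ≠ 0}` has the same class modulo the saturation as some
  -- function on `U_σ`, so its class lies in the finite-dimensional image of `φ σ`.
  refine finite_quotient_of_forall (fun σ => (S σ).mkQ ∘ₗ (affineRing c).val.toLinearMap) _ hfin
    (fun σ b => ?_) fun b hb σ => (Submodule.Quotient.mk_eq_zero (S σ)).1 (hb σ)
  obtain ⟨u, hu⟩ := hu σ
  obtain ⟨M, hM⟩ := exists_inv_vertexCoord_pow_mul_mem hc σ b.2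
  obtain ⟨g, hg, hbg⟩ := exists_sub_mem_saturation hu (hM M le_rfl)
  exact ⟨⟨g, hg⟩, ((Submodule.Quotient.eq _).2 hbg).symm⟩

theorem linForm_ne_zero {i : Fin k} {j : Fin (n i + 1)} (h : c i j ≠ 0) : linForm c i ≠ 0 := by
  intro h0
  have hli : LinearIndependent K fun j : Fin (n i + 1) => coord K n i j := by
    have h1 := (linearIndependent_laurentMonomial (K := K) (n := n)).comp
      (fun j : Fin (n i + 1) => Pi.single ⟨i, j⟩ 1) ?_
    · convert h1 using 2 with j
      rw [Function.comp_apply, laurentMonomial_single, zpow_one]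
    · intro j l hjl
      by_contra hne
      have h2 : (Pi.single ⟨i, j⟩ 1 : (Σ i : Fin k, Fin (n i + 1)) → ℤ) ⟨i, j⟩ =
          (Pi.single ⟨i, l⟩ 1 : (Σ i : Fin k, Fin (n i + 1)) → ℤ) ⟨i, j⟩ := congrFun hjl ⟨i, j⟩
      rw [Pi.single_eq_same, Pi.single_eq_of_ne (by simpa using hne)] at h2
      exact one_ne_zero h2
  exact h (Fintype.linearIndependent_iff.1 hli (c i) h0 j)

/-- Over an infinite field, some linear form vanishes at none of finitely many nonzero vectors. -/
theorem exists_forall_sum_mul_ne_zero [Infinite K] {ι T : Type*} [Fintype ι] [Finite T]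
    (p : T → ι → K) (hp : ∀ t, p t ≠ 0) : ∃ c : ι → K, ∀ t, ∑ j, c j * p t j ≠ 0 := by
  classical
  have := Fintype.ofFinite T
  let W : T → Submodule K (ι → K) := fun t => LinearMap.ker (Fintype.linearCombination K (p t))
  -- A vector space over an infinite field is not a finite union of proper subspaces.
  have h := Subspace.biUnion_ne_univ_of_top_notMem (s := Finset.univ.image W) ?_
  · rw [Set.ne_univ_iff_exists_notMem] at h
    obtain ⟨c, hc⟩ := h
    refine ⟨c, fun t ht => hc ?_⟩
    refine Set.mem_iUnion₂.2 ⟨W t, Finset.mem_image_of_mem _ (Finset.mem_univ t), ?_⟩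
    exact LinearMap.mem_ker.2 (by simpa [Fintype.linearCombination_apply] using ht)
  · intro h
    obtain ⟨t, -, ht⟩ := Finset.mem_image.1 h
    apply hp t
    funext j
    have h1 : Pi.single j 1 ∈ W t := ht ▸ Submodule.mem_top
    simpa [W, Fintype.linearCombination_apply_single] using LinearMap.mem_ker.1 h1

/-- A non-unit lies in a maximal ideal, whose residue field is finite over the algebraically closed
`K` and so equals `K`. -/
theorem isUnit_of_forall_algHom_ne_zero [IsAlgClosed K] {Q : Type*} [CommRing Q] [Algebra K Q]
    [Module.Finite K Q] {q : Q} (h : ∀ χ : Q →ₐ[K] K, χ q ≠ 0) : IsUnit q := by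
  by_contra hq
  obtain ⟨m, hm, hqm⟩ := exists_max_ideal_of_mem_nonunits hq
  let _ := Ideal.Quotient.field m
  let e : K ≃ₐ[K] Q ⧸ m := AlgEquiv.ofBijective (Algebra.ofId K (Q ⧸ m))
    IsAlgClosed.algebraMap_bijective_of_isIntegral
  refine h (e.symm.toAlgHom.comp (Ideal.Quotient.mkₐ K m)) ?_
  change e.symm (Ideal.Quotient.mk m q) = 0
  rw [Ideal.Quotient.eq_zero_iff_mem.2 hqm, map_zero]

theorem formRatio_eq_prod (c : (i : Fin k) → Fin (n i + 1) → K) (σ : Chart n) :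
    formRatio c σ = ∏ i, ∑ j, c i j • affineCoord K n σ i j := by
  apply Subtype.ext
  change (vertexCoord c σ)⁻¹ = _
  rw [inv_vertexCoord_eq, SubmonoidClass.coe_finsetProd]
  refine Finset.prod_congr rfl fun i _ => ?_
  rw [AddSubmonoidClass.coe_finsetSum, linForm, Finset.sum_div]
  exact Finset.sum_congr rfl fun j _ => smul_div_assoc _ _ _

/-- The closed points of `Z` over the charts are the finitely many characters of its coordinate
rings; general `ℓ_i` are nonzero at all of them. -/
theorem exists_isUnitOn [IsAlgClosed K] (hZ : Z.IsZeroDimensional) :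
    ∃ c : (i : Fin k) → Fin (n i + 1) → K, (∀ i, linForm c i ≠ 0) ∧ Z.IsUnitOn c := by
  have hfin := fun σ => hZ.finite σ
  have : Infinite K := IsAlgClosed.instInfinite
  have h : ∀ i, ∃ ci : Fin (n i + 1) → K,
      -- The extra index `none` carries the vector `(1, 0, …, 0)`; it forces `ci 0 ≠ 0`, so `ℓ_i ≠
      -- 0` even when `Z` is empty.
      ∀ t : Option (Σ σ : Chart n, (chartRing K n σ ⧸ Z.ideal σ) →ₐ[K] K),
        ∑ j, ci j * t.elim (Pi.single 0 1 : Fin (n i + 1) → K)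
          (fun s j => s.2 (Ideal.Quotient.mk _ (affineCoord K n s.1 i j))) j ≠ 0 := by
    intro i
    refine exists_forall_sum_mul_ne_zero _ ?_
    rintro (_ | ⟨σ, χ⟩) h0
    · have h1 := congrFun h0 0
      simp at h1
    · have h1 := congrFun h0 (σ i)
      have h2 : affineCoord K n σ i (σ i) = 1 :=
        Subtype.ext (div_self (coord_ne_zero K n i (σ i)))
      simp [h2] at h1
  choose c hc using h
  refine ⟨c, fun i => ?_, fun σ => ?_⟩
  · have h1 := hc i none
    refine linForm_ne_zero (j := 0) fun h0 => h1 ?_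
    simp [Pi.single_apply, h0]
  · have hu : IsUnit (Ideal.Quotient.mk (Z.ideal σ) (formRatio c σ)) := by
      refine isUnit_of_forall_algHom_ne_zero (K := K) fun χ => ?_
      have h1 : χ (Ideal.Quotient.mk (Z.ideal σ) (formRatio c σ)) =
          ∏ i, ∑ j, c i j * χ (Ideal.Quotient.mk (Z.ideal σ) (affineCoord K n σ i j)) := by
        change (χ.comp (Ideal.Quotient.mkₐ K (Z.ideal σ))) (formRatio c σ) = _
        rw [formRatio_eq_prod, map_prod]
        refine Finset.prod_congr rfl fun i _ => ?_
        rw [map_sum]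
        refine Finset.sum_congr rfl fun j _ => ?_
        rw [map_smul, smul_eq_mul]
        rfl
      rw [h1]
      exact Finset.prod_ne_zero_iff.2 fun i _ => hc i (some ⟨σ, χ⟩)
    obtain ⟨v, hv⟩ := hu.exists_right_inv
    obtain ⟨u, rfl⟩ := Ideal.Quotient.mk_surjective v
    refine ⟨u, ?_⟩
    rw [← Ideal.Quotient.eq_zero_iff_mem, map_sub, map_mul, hv, map_one, sub_self]

end Finiteness

/-! ### Multiplication by `x_{ij} / ℓ_i` and the fibers of `π_i` -/

section Fibers

variable {K : Type*} [Field K] {k : ℕ} {n : Fin k → ℕ}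
  {c : (i : Fin k) → Fin (n i + 1) → K} {Z : ClosedSubscheme K n}

/-- The function `x_{ij} / ℓ_i` as an element of the coordinate ring of `{ℓ_i ≠ 0 for all i}`. -/
def affineFormCoord (c : (i : Fin k) → Fin (n i + 1) → K) (i : Fin k) (j : Fin (n i + 1)) :
    affineRing c :=
  ⟨formCoord c i j, formCoord_mem_affineRing i j⟩

theorem sum_smul_affineFormCoord (hc : ∀ i, linForm c i ≠ 0) (i : Fin k) :
    ∑ j, c i j • affineFormCoord c i j = 1 := by
  apply Subtype.ext
  rw [AddSubmonoidClass.coe_finsetSum]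
  exact sum_smul_formCoord hc i

theorem formMonomial_add_single (a : Fin k → ℕ) (i : Fin k) :
    formMonomial c (a + Pi.single i 1) = formMonomial c a * linForm c i := by
  unfold formMonomial
  simp only [Pi.add_apply, pow_add, Finset.prod_mul_distrib]
  congr 1
  rw [Finset.prod_eq_single i]
  · simp
  · intro j _ hj
    simp [hj]
  · simp

theorem affineFormCoord_mul_mem_formSections (hc : ∀ i, linForm c i ≠ 0) {a : Fin k → ℕ}
    (i : Fin k) (j : Fin (n i + 1)) {b : affineRing c} (hb : b ∈ formSections c a) :
    affineFormCoord c i j * b ∈ formSections c (a + Pi.single i 1) := by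
  have h := coord_mul_mem_globalSections i j (mem_formSections.1 hb)
  rw [mem_formSections, formMonomial_add_single]
  have h1 : formMonomial c a * linForm c i * ((affineFormCoord c i j * b : affineRing c) : Frac K n)
      = coord K n i j * (formMonomial c a * b) := by
    change formMonomial c a * linForm c i * (coord K n i j / linForm c i * b) = _
    have := hc i
    field_simp
  rwa [h1]

/-- Multiply by `1 = ∑ c_{ij} x_{ij} / ℓ_i`. -/
theorem formSections_le_add_single (hc : ∀ i, linForm c i ≠ 0) (a : Fin k → ℕ) (i : Fin k) :
    formSections c a ≤ formSections c (a + Pi.single i 1) := by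
  intro b hb
  rw [← one_mul b, ← sum_smul_affineFormCoord hc i, Finset.sum_mul]
  refine sum_mem fun j _ => ?_
  rw [smul_mul_assoc]
  exact Submodule.smul_mem _ _ (affineFormCoord_mul_mem_formSections hc i j hb)

theorem formSections_add_single_le (hc : ∀ i, linForm c i ≠ 0) {a : Fin k → ℕ} (i : Fin k)
    {N : Submodule K (affineRing c)}
    (hN : ∀ j, ∀ b ∈ formSections c a, affineFormCoord c i j * b ∈ N) :
    formSections c (a + Pi.single i 1) ≤ N := by
  have hl := formMonomial_ne_zero hc a
  have hl' := formMonomial_ne_zero hc (a + Pi.single i 1)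
  have h := globalSections_add_single_le (a := a) i
    (M := N.map (LinearMap.mulLeft K (formMonomial c (a + Pi.single i 1)) ∘ₗ
      (affineRing c).val.toLinearMap)) ?_
  · intro b hb
    obtain ⟨b', hb', hbb⟩ := h hb
    have h1 : b' = b := Subtype.ext (mul_left_cancel₀ hl' hbb)
    exact h1 ▸ hb'
  · intro j f hf
    let b : affineRing c := ⟨_, div_formMonomial_mem_affineRing hc hf⟩
    have hb : b ∈ formSections c a := by
      rw [mem_formSections, mul_div_cancel₀ _ hl]
      exact hf
    refine ⟨_, hN j b hb, ?_⟩
    change formMonomial c (a + Pi.single i 1) *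
      (coord K n i j / linForm c i * (f / formMonomial c a)) = _
    rw [formMonomial_add_single]
    have := hc i
    field_simp

/-- The equations of `π_i⁻¹(p)` in the coordinate ring of `{ℓ_i ≠ 0 for all i}`. -/
theorem coord_relation_mem_affineIdeal (hc : ∀ i, linForm c i ≠ 0) {i : Fin k}
    {p : Projectivization K (Fin (n i + 1) → K)} (hZ : Z.IsContainedIn (fiber K n i p))
    (j l : Fin (n i + 1)) :
    p.rep j • affineFormCoord c i l - p.rep l • affineFormCoord c i j ∈ Z.affineIdeal hc := by
  intro σ
  have h : p.rep j • affineCoord K n σ i l - p.rep l • affineCoord K n σ i j ∈ Z.ideal σ :=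
    hZ σ (Ideal.subset_span ⟨j, l, rfl⟩)
  obtain ⟨M, hM⟩ := exists_inv_vertexCoord_pow_mul_mem hc σ
    (formCoord_mem_affineRing (c := c) i (σ i))
  have h1 := mul_mem_saturation (l := formRatio c σ) (hM M le_rfl)
    (idealImage_le_saturation _ _ (coe_mem_idealImage.2 h))
  have h2 : formCoord c i (σ i) * ((p.rep j • affineCoord K n σ i l -
      p.rep l • affineCoord K n σ i j : chartRing K n σ) : Frac K n) =
      p.rep j • formCoord c i l - p.rep l • formCoord c i j := by
    change formCoord c i (σ i) * (p.rep j • (coord K n i l / coord K n i (σ i)) -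
      p.rep l • (coord K n i j / coord K n i (σ i))) = _
    unfold formCoord
    have h3 := coord_ne_zero K n i (σ i)
    have h4 := hc i
    simp only [Algebra.smul_def]
    field_simp
  rw [h2] at h1
  exact h1

/-- On `π_i⁻¹(p)` the function `x_{ij} / ℓ_i` is the constant `p_j / ℓ_i(p)`, so multiplying by it
yields nothing new modulo `J`. -/
theorem formSections_add_single_sup_eq (hc : ∀ i, linForm c i ≠ 0) (a : Fin k → ℕ) {i : Fin k}
    {p : Projectivization K (Fin (n i + 1) → K)} (hZ : Z.IsContainedIn (fiber K n i p)) :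
    formSections c (a + Pi.single i 1) ⊔ (Z.affineIdeal hc).restrictScalars K =
      formSections c a ⊔ (Z.affineIdeal hc).restrictScalars K := by
  refine le_antisymm (sup_le (formSections_add_single_le hc i fun j b hb => ?_) le_sup_right)
    (sup_le_sup_right (formSections_le_add_single hc a i) _)
  let J := Z.affineIdeal hc
  let r := ∑ l, c i l * p.rep l
  have key : ∀ j, r • affineFormCoord c i j - algebraMap K (affineRing c) (p.rep j) ∈ J := by
    intro j
    have h1 : r • affineFormCoord c i j - algebraMap K (affineRing c) (p.rep j) =
        ∑ l, c i l • (p.rep l • affineFormCoord c i j - p.rep j • affineFormCoord c i l) := by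
      have h2 : algebraMap K (affineRing c) (p.rep j) =
          p.rep j • ∑ l, c i l • affineFormCoord c i l := by
        rw [sum_smul_affineFormCoord hc, Algebra.smul_def, mul_one]
      rw [h2, Finset.sum_smul, Finset.smul_sum, ← Finset.sum_sub_distrib]
      refine Finset.sum_congr rfl fun l _ => ?_
      rw [smul_sub, smul_smul, smul_smul, smul_smul, mul_comm (p.rep j)]
    rw [h1]
    exact sum_mem fun l _ => Submodule.smul_of_tower_mem J _
      (coord_relation_mem_affineIdeal hc hZ l j)
  -- `r = ℓ_i(p)`. If it is zero, the fiber misses `{ℓ_i ≠ 0}`, and `J` contains a nonzero constant.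
  by_cases hr : r = 0
  · obtain ⟨l, hl⟩ := Function.ne_iff.1 p.rep_nonzero
    have h1 := key l
    rw [hr, zero_smul, zero_sub, neg_mem_iff] at h1
    have h2 : J = ⊤ := Ideal.eq_top_of_isUnit_mem _ h1
      ((isUnit_iff_ne_zero.2 hl).map (algebraMap K (affineRing c)))
    refine Submodule.mem_sup_right ?_
    rw [Submodule.restrictScalars_mem]
    change _ ∈ J
    rw [h2]
    trivial
  · have h1 := J.mul_mem_right b (key j)
    have h2 : affineFormCoord c i j * b = (r⁻¹ * p.rep j) • b +
        r⁻¹ • ((r • affineFormCoord c i j - algebraMap K (affineRing c) (p.rep j)) * b) := by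
      rw [sub_mul, smul_sub, smul_mul_assoc, smul_smul, inv_mul_cancel₀ hr, one_smul,
        ← Algebra.smul_def, smul_smul]
      abel
    rw [h2]
    exact Submodule.add_mem_sup (Submodule.smul_mem _ _ hb)
      (Submodule.smul_of_tower_mem J _ h1)

theorem affineIdeal_mono (hc : ∀ i, linForm c i ≠ 0) {W : ClosedSubscheme K n}
    (h : W.IsContainedIn Z) : Z.affineIdeal hc ≤ W.affineIdeal hc :=
  fun _ hb σ => saturation_mono (h σ) _ (hb σ)

theorem isUnitOn_of_isContainedIn {W : ClosedSubscheme K n} (h : W.IsContainedIn Z)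
    (hZ : Z.IsUnitOn c) : W.IsUnitOn c := fun σ =>
  let ⟨u, hu⟩ := hZ σ
  ⟨u, h σ hu⟩

theorem inter_isContainedIn_left (Z W : ClosedSubscheme K n) : (Z.inter W).IsContainedIn Z :=
  fun _ => le_sup_left

theorem inter_isContainedIn_right (Z W : ClosedSubscheme K n) : (Z.inter W).IsContainedIn W :=
  fun _ => le_sup_right

theorem exists_vertexCoord_pow_mul_mem_affineIdeal (hc : ∀ i, linForm c i ≠ 0) (σ : Chart n)
    {h : Frac K n} (hh : h ∈ idealImage (Z.ideal σ)) :
    ∃ M : ℕ, ∀ m, M ≤ m → vertexCoord c σ ^ m * h ∈ idealImage (Z.affineIdeal hc) := by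
  obtain ⟨N, hN⟩ := exists_vertexCoord_pow_mul_mem (c := c) σ (idealImage_le hh)
  have h1 : ∀ τ, ∃ M : ℕ, ∀ m, M ≤ m → transition K σ τ ^ m * h ∈ idealImage (Z.ideal τ) :=
    fun τ => exists_transition_pow_mul_mem_idealImage Z σ τ (idealImage_le_overlap_left σ τ hh)
  choose M hM using h1
  refine ⟨max N (Finset.univ.sup M), fun m hm => ?_⟩
  refine ⟨⟨_, hN m (le_trans (le_max_left _ _) hm)⟩, fun τ => ⟨m, ?_⟩, rfl⟩
  change (vertexCoord c τ)⁻¹ ^ m * (vertexCoord c σ ^ m * h) ∈ _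
  rw [← mul_assoc, ← mul_pow, inv_vertexCoord_mul_vertexCoord hc]
  exact hM τ m (((Finset.le_sup (Finset.mem_univ τ)).trans (le_max_right _ _)).trans hm)

/-- Both summands of the ideal of `Z ∩ π_i⁻¹(p)` on a chart enter the right side after
multiplication by a power of `vertexCoord c σ`; the partition of unity removes that factor. -/
theorem affineIdeal_inter_fiber_le (hc : ∀ i, linForm c i ≠ 0) {i : Fin k}
    (p : Projectivization K (Fin (n i + 1) → K)) :
    (Z.inter (fiber K n i p)).affineIdeal hc ≤ Z.affineIdeal hc ⊔ Ideal.span {f | ∃ j l,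
      f = p.rep j • affineFormCoord c i l - p.rep l • affineFormCoord c i j} := by
  let D := Z.affineIdeal hc ⊔ Ideal.span {f | ∃ j l,
      f = p.rep j • affineFormCoord c i l - p.rep l • affineFormCoord c i j}
  intro b hb
  have h : ∀ σ, ∃ M : ℕ, ∀ m, M ≤ m → vertexCoord c σ ^ m * (b : Frac K n) ∈ idealImage D := by
    intro σ
    obtain ⟨N, g, hg, hgb⟩ := hb σ
    obtain ⟨g₁, hg₁, g₂, hg₂, rfl⟩ := Submodule.mem_sup.1 hg
    obtain ⟨M₁, hM₁⟩ := exists_vertexCoord_pow_mul_mem_affineIdeal (Z := Z) hc σ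
      (coe_mem_idealImage.2 hg₁)
    have hgen : ∀ g ∈ {f | ∃ j l : Fin (n i + 1),
        f = p.rep j • affineCoord K n σ i l - p.rep l • affineCoord K n σ i j},
        ∃ M : ℕ, ∀ m, M ≤ m → vertexCoord c σ ^ m * (g : Frac K n) ∈ idealImage D := by
      rintro _ ⟨j, l, rfl⟩
      obtain ⟨M, hM⟩ := exists_vertexCoord_pow_mul_mem (c := c) σ
        (linForm_div_coord_mem_chartRing (c := c) σ i)
      refine ⟨M, fun m hm => ?_⟩
      have h1 : p.rep j • affineFormCoord c i l - p.rep l • affineFormCoord c i j ∈ D :=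
        (le_sup_right : _ ≤ D) (Ideal.subset_span ⟨j, l, rfl⟩)
      have h2 := mul_mem_idealImage (hM m hm) (coe_mem_idealImage.2 h1)
      have h3 : vertexCoord c σ ^ m * (linForm c i / coord K n i (σ i)) *
          ((p.rep j • affineFormCoord c i l - p.rep l • affineFormCoord c i j :
            affineRing c) : Frac K n) =
          vertexCoord c σ ^ m * ((p.rep j • affineCoord K n σ i l -
            p.rep l • affineCoord K n σ i j : chartRing K n σ) : Frac K n) := by
        change vertexCoord c σ ^ m * (linForm c i / coord K n i (σ i)) *
          (p.rep j • (coord K n i l / linForm c i) - p.rep l • (coord K n i j / linForm c i)) =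
          vertexCoord c σ ^ m * (p.rep j • (coord K n i l / coord K n i (σ i)) -
            p.rep l • (coord K n i j / coord K n i (σ i)))
        have h4 := coord_ne_zero K n i (σ i)
        have h5 := hc i
        simp only [Algebra.smul_def]
        field_simp
      rwa [h3] at h2
    obtain ⟨M₂, hM₂⟩ := exists_pow_mul_mem_idealImage_of_span
      (fun u hu => exists_vertexCoord_pow_mul_mem σ hu) hgen (coe_mem_idealImage.2 hg₂)
    refine ⟨max M₁ M₂, fun m hm => ?_⟩
    have h1 : vertexCoord c σ ^ m * (g₁ : Frac K n) ∈ idealImage D := by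
      obtain ⟨f, hf, hfe⟩ := hM₁ m (le_trans (le_max_left _ _) hm)
      exact ⟨f, (le_sup_left : Z.affineIdeal hc ≤ D) hf, hfe⟩
    have h2 := add_mem h1 (hM₂ m (le_trans (le_max_right _ _) hm))
    have h3 : (g₁ : Frac K n) + g₂ = (vertexCoord c σ)⁻¹ ^ N * b := hgb
    rw [← mul_add, h3] at h2
    have h4 := mul_mem_idealImage (pow_mem (vertexCoord_mem_affineRing σ) N) h2
    have h5 : vertexCoord c σ ^ N * (vertexCoord c σ ^ m * ((vertexCoord c σ)⁻¹ ^ N * b)) =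
        vertexCoord c σ ^ m * (b : Frac K n) := by
      rw [mul_left_comm, ← mul_assoc (vertexCoord c σ ^ N), ← mul_pow,
        mul_inv_cancel₀ (vertexCoord_ne_zero hc σ), one_pow, one_mul]
    rwa [h5] at h4
  choose M hM using h
  obtain ⟨e, he, he1⟩ := exists_sum_mul_vertexCoord_pow hc (Finset.univ.sup M)
  rw [← coe_mem_idealImage, ← one_mul (b : Frac K n), ← he1, Finset.sum_mul]
  refine sum_mem fun σ _ => ?_
  rw [mul_assoc]
  exact mul_mem_idealImage (he σ) (hM σ _ (Finset.le_sup (Finset.mem_univ σ)))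

/-- If the sections of `𝒪_X(a)` modulo an invariant proper subspace do not span the functions on
`Z`, then this already happens on a fiber of `π_i`. -/
theorem exists_formSections_sup_inter_fiber_ne_top [IsAlgClosed K] (hc : ∀ i, linForm c i ≠ 0)
    {a : Fin k → ℕ} {i : Fin k} {U : Submodule K (affineRing c)}
    [Module.Finite K (affineRing c ⧸ U)] (hU : U ≠ ⊤) (haU : formSections c a ≤ U)
    (hZU : (Z.affineIdeal hc).restrictScalars K ≤ U)
    (hmul : ∀ j, ∀ b ∈ U, affineFormCoord c i j * b ∈ U) :
    ∃ p : Projectivization K (Fin (n i + 1) → K), formSections c a ⊔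
      ((Z.inter (fiber K n i p)).affineIdeal hc).restrictScalars K ≠ ⊤ := by
  obtain ⟨μ, W, hUW, hW, hμ⟩ := exists_le_forall_sub_smul_mem
    (fun j => LinearMap.mulLeft K (affineFormCoord c i j))
    (fun j l x => mul_left_comm _ _ _) U hU hmul
  -- If all eigenvalues were zero, `W` would contain every `∑ c_{ij} (x_{ij} / ℓ_i) x = x`.
  have hμ0 : μ ≠ 0 := by
    rintro rfl
    refine hW (eq_top_iff.2 fun x _ => ?_)
    rw [← one_mul x, ← sum_smul_affineFormCoord hc i, Finset.sum_mul]
    refine sum_mem fun j _ => ?_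
    rw [smul_mul_assoc]
    refine Submodule.smul_mem _ _ ?_
    simpa using hμ j x
  let p := Projectivization.mk K μ hμ0
  obtain ⟨r, hr⟩ := Projectivization.exists_smul_eq_mk_rep K μ hμ0
  have hrep : ∀ j, p.rep j = r * μ j := fun j => (congrFun hr j).symm
  refine ⟨p, fun htop => hW (eq_top_iff.2 (htop ▸ sup_le (haU.trans hUW) ?_))⟩
  intro b hb
  obtain ⟨b₁, hb₁, b₂, hb₂, rfl⟩ := Submodule.mem_sup.1 (affineIdeal_inter_fiber_le hc p hb)
  refine add_mem (hUW (hZU hb₁)) ?_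
  clear hb
  induction hb₂ using Submodule.closure_induction with
  | zero => exact zero_mem _
  | add x y _ _ hx hy => exact add_mem hx hy
  | smul_mem x y hy =>
    obtain ⟨j, l, rfl⟩ := hy
    -- `W` need not be an ideal, but the eigenvalue relation holds for every `x`. As `p.rep` is
    -- proportional to `μ`, the terms in `μ` cancel and leave `x` times the fiber equation.
    have h1 := sub_mem (Submodule.smul_mem W (p.rep j) (hμ l x))
      (Submodule.smul_mem W (p.rep l) (hμ j x))
    have h2 : p.rep j • (affineFormCoord c i l * x - μ l • x) -
        p.rep l • (affineFormCoord c i j * x - μ j • x) =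
        x • (p.rep j • affineFormCoord c i l - p.rep l • affineFormCoord c i j) := by
      rw [smul_sub, smul_sub, smul_smul, smul_smul, hrep, hrep, mul_right_comm (r : K) (μ l),
        smul_eq_mul, mul_sub, mul_smul_comm, mul_smul_comm, mul_comm x, mul_comm x]
      abel
    rw [← h2]
    exact h1

end Fibers

end MultiProj

end

theorem proposition2p6 {K : Type*} [Field K] [IsAlgClosed K] [CharZero K] {k : ℕ}
    (n : Fin k → ℕ) (Z : MultiProj.ClosedSubscheme K n) (hZ : Z.IsZeroDimensional)
    (i : Fin k) (a : Fin k → ℕ) :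
    -- the first cohomology of every twist is finite-dimensional, so that `h1` is its dimension
    (∀ b : Fin k → ℕ, Module.Finite K (Z.H1 b)) ∧
    -- (1)
    Z.h1 (a + Pi.single i 1) ≤ Z.h1 a ∧
    -- (2)
    ((∃ p : Projectivization K (Fin (n i + 1) → K),
        Z.IsContainedIn (MultiProj.fiber K n i p)) →
      Z.h1 (a + Pi.single i 1) = Z.h1 a) ∧
    -- (3)
    (∃ ℓ : ℕ,
      Tendsto (fun t : ℕ => Z.h1 (a + t • Pi.single i 1)) atTop (𝓝 ℓ) ∧
      (0 < ℓ ↔ ∃ p : Projectivization K (Fin (n i + 1) → K),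
        0 < (Z.inter (MultiProj.fiber K n i p)).h1 a)) := by
  open MultiProj in
  obtain ⟨c, hc, hu⟩ := exists_isUnitOn hZ
  have hJ := finite_quotient_affineIdeal hc hZ hu
  have hfin : ∀ b, Module.Finite K
      (affineRing c ⧸ (formSections c b ⊔ (Z.affineIdeal hc).restrictScalars K)) :=
    fun b => finite_quotient_of_le le_sup_right
  -- The same `ℓ_i` serve every `W ⊆ Z`, so `Z` and its fibers are compared inside one ring.
  have hh1 : ∀ {W : ClosedSubscheme K n}, W.IsContainedIn Z → ∀ b, W.h1 b = Module.finrank K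
      (affineRing c ⧸ (formSections c b ⊔ (W.affineIdeal hc).restrictScalars K)) := by
    intro W hW b
    obtain ⟨e⟩ := nonempty_quotient_equiv_H1 hc (isUnitOn_of_isContainedIn hW hu) b
    exact e.finrank_eq.symm
  have hZZ : Z.IsContainedIn Z := fun _ => le_rfl
  have hle : ∀ b, Z.h1 (b + Pi.single i 1) ≤ Z.h1 b := by
    intro b
    rw [hh1 hZZ, hh1 hZZ]
    exact finrank_quotient_le_of_le (sup_le_sup_right (formSections_le_add_single hc b i) _)
  have hstep : ∀ t : ℕ, a + (t + 1) • Pi.single i 1 = a + t • Pi.single i 1 + Pi.single i 1 := by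
    intro t
    rw [succ_nsmul, add_assoc]
  refine ⟨fun b => ?_, hle a, ?_, ?_⟩
  · obtain ⟨e⟩ := nonempty_quotient_equiv_H1 hc hu b
    exact Module.Finite.equiv e
  · rintro ⟨p, hp⟩
    rw [hh1 hZZ, hh1 hZZ, formSections_add_single_sup_eq hc a hp]
  · have hanti : Antitone fun t : ℕ => Z.h1 (a + t • Pi.single i 1) := by
      refine antitone_nat_of_succ_le fun t => ?_
      rw [hstep]
      exact hle _
    have hmin : ∀ f : ℕ → ℕ, ∃ T, ∀ t, f T ≤ f t := fun f =>
      ⟨Function.argmin f, fun t => Function.argmin_le f t⟩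
    obtain ⟨T, hT⟩ := hmin fun t => Z.h1 (a + t • Pi.single i 1)
    have hconst : ∀ t, T ≤ t → Z.h1 (a + t • Pi.single i 1) = Z.h1 (a + T • Pi.single i 1) :=
      fun t ht => le_antisymm (hanti ht) (hT t)
    refine ⟨_, tendsto_atTop_of_eventually_const hconst, ?_⟩
    rw [hh1 hZZ, finrank_quotient_pos_iff]
    have hpos : ∀ p, 0 < (Z.inter (fiber K n i p)).h1 a ↔ formSections c a ⊔
        ((Z.inter (fiber K n i p)).affineIdeal hc).restrictScalars K ≠ ⊤ := by
      intro p
      have h1 : (Z.affineIdeal hc).restrictScalars K ≤ formSections c a ⊔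
          ((Z.inter (fiber K n i p)).affineIdeal hc).restrictScalars K :=
        le_trans (affineIdeal_mono hc (inter_isContainedIn_left Z _)) le_sup_right
      have := finite_quotient_of_le h1
      rw [hh1 (inter_isContainedIn_left Z _), finrank_quotient_pos_iff]
    constructor
    · intro hne
      have haT : formSections c a ≤ formSections c (a + T • Pi.single i 1) := by
        have h : Monotone fun t : ℕ => formSections c (a + t • Pi.single i 1) := by
          refine monotone_nat_of_le_succ fun t => ?_
          rw [hstep]
          exact formSections_le_add_single hc _ i
        simpa using h (Nat.zero_le T)
      -- Equal `h¹` at `T` and `T + 1` makes the nested subspaces equal; hence multiplication by any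
      -- `x_{ij} / ℓ_i` preserves this one.
      have hstab : formSections c (a + T • Pi.single i 1) ⊔ (Z.affineIdeal hc).restrictScalars K =
          formSections c (a + T • Pi.single i 1 + Pi.single i 1) ⊔
            (Z.affineIdeal hc).restrictScalars K := by
        refine eq_of_le_of_finrank_quotient_eq
          (sup_le_sup_right (formSections_le_add_single hc _ i) _) ?_
        rw [← hh1 hZZ, ← hh1 hZZ, ← hstep]
        exact (hconst (T + 1) (Nat.le_succ T)).symm
      have hmul : ∀ j, ∀ b ∈ formSections c (a + T • Pi.single i 1) ⊔
          (Z.affineIdeal hc).restrictScalars K, affineFormCoord c i j * b ∈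
          formSections c (a + T • Pi.single i 1) ⊔ (Z.affineIdeal hc).restrictScalars K := by
        intro j b hb
        rw [hstab]
        obtain ⟨v, hv, w, hw, rfl⟩ := Submodule.mem_sup.1 hb
        rw [mul_add]
        exact Submodule.add_mem_sup (affineFormCoord_mul_mem_formSections hc i j hv)
          ((Z.affineIdeal hc).mul_mem_left _ hw)
      obtain ⟨p, hp⟩ := exists_formSections_sup_inter_fiber_ne_top hc hne
        (haT.trans le_sup_left) le_sup_right hmul
      exact ⟨p, (hpos p).2 hp⟩
    · rintro ⟨p, hp⟩ htop
      refine (hpos p).1 hp ?_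
      -- Part (2) applied repeatedly to `Z ∩ π_i⁻¹(p)`, at the level of subspaces. The subspace at
      -- `T` contains the one for `Z`, so it is everything if the limit is zero.
      have h : ∀ t : ℕ, formSections c (a + t • Pi.single i 1) ⊔
          ((Z.inter (fiber K n i p)).affineIdeal hc).restrictScalars K = formSections c a ⊔
          ((Z.inter (fiber K n i p)).affineIdeal hc).restrictScalars K := by
        intro t
        induction t with
        | zero => simp
        | succ t ih =>
          rw [hstep, formSections_add_single_sup_eq hc _ (inter_isContainedIn_right Z _), ih]
      rw [← h T, eq_top_iff, ← htop]
      have hJp : (Z.affineIdeal hc).restrictScalars K ≤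
          ((Z.inter (fiber K n i p)).affineIdeal hc).restrictScalars K :=
        affineIdeal_mono hc (inter_isContainedIn_left Z _)
      exact sup_le_sup_left hJp _
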